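/- Let $B>0$ and let $V:\mathbb{R}^2\to\mathbb{R}$ be measurable. Let $$H_B=\Big(-i\frac{\partial}{\partial x_1}+\frac{Bx_2}{2}\Big)^2+\Big(-i\frac{\partial}{\partial x_2}-\frac{Bx_1}{2}\Big)^2$$ be the Landau Hamiltonian in $L^2(\mathbb{R}^2)$, and let $H_B+V$ be the operator associated with the quadratic form $$u\mapsto\int_{\mathbb{R}^2}\Big(\big|(-i\partial_1+\tfrac{Bx_2}{2})u\big|^2+\big|(-i\partial_2-\tfrac{Bx_1}{2})u\big|^2+V|u|^2\Big)\,dx$$ on the set of all $u\in L^2(\mathbb{R}^2)$ for which $(-i\partial_1+\frac{Bx_2}{2})u$ and $(-i\partial_2-\frac{Bx_1}{2})u$ (in the sense of distributions) belong to $L^2(\mathbb{R}^2)$ and $\int|V||u|^2\,dx<\infty$. Write $t_-=\max(-t,0)$. Then $$\mathrm{Tr}\,(H_B+V)_-\le 3\cdot\frac{B}{2\pi}\sum_{m=0}^{\infty}\int_{\mathbb{R}^2}\big((2m+1)B+V(x)\big)_-\,dx .$$ Both sides take values in $[0,\infty]$. The left side is the trace of the negative part of $H_B+V$ (when finite, the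 sum of the absolute values of the negative eigenvalues, counted with multiplicity), and it is set to be $\infty$ if $H_B+V$ is not self-adjoint and bounded from below; so the inequality includes the assertion that $H_B+V$ is self-adjoint and bounded from below whenever the right side is finite. (If the form domain is not dense, $H_B+V$ is understood as an operator in its closure.) -/

import Mathlib

open MeasureTheory
open scoped ENNReal ContDiff ComplexConjugate

noncomputable section

/-! ### Negative part of a lower semibounded self-adjoint operator -/

section NegPart

variable {H : Type*} [NormedAddCommGroup H] [InnerProductSpace ℂ H] [CompleteSpace H]

/-- For an operator `A` on `H` with graph `G`, the bounded operator `R` is `(A + c)⁻¹` and it is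
positive. Such `c` and `R` exist exactly when `A` is self-adjoint and bounded from below.
(If `A` is self-adjoint only in a closed subspace `K` of `H`, its graph is completed by
`{0} × Kᗮ`, and then `R` vanishes on `Kᗮ`.) -/
def IsShiftedInverse (G : Set (H × H)) (c : ℝ) (R : H →L[ℂ] H) : Prop :=
  R.IsPositive ∧ ∀ f u : H, (u, f - (c : ℂ) • u) ∈ G ↔ R f = u

/-- The negative part `A₋` of `A`, as a function of `R = (A + c)⁻¹` in the continuous functional
calculus: the spectral value `t = (a + c)⁻¹` of `R` is sent to `max (c - 1 / t) 0 = max (-a) 0`,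
written so that `t = 0` is sent to `0`. -/
def negPartOfShiftedInverse (c : ℝ) (R : H →L[ℂ] H) : H →L[ℂ] H :=
  cfc (fun t : ℝ => max (c * t - 1) 0 / t) R

open Classical in
/-- The trace `Tr A₋ ∈ [0, ∞]` of the negative part of the operator `A` with graph `G`, computed
in the Hilbert basis `b`. The negative part does not depend on the choice of the shift `c`.
The value is `∞` if `A` is not self-adjoint and bounded from below. -/
def traceNegPart {ι : Type*} (b : HilbertBasis ι ℂ H) (G : Set (H × H)) : ℝ≥0∞ :=
  if h : ∃ p : ℝ × (H →L[ℂ] H), IsShiftedInverse G p.1 p.2 then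
    ∑' i, ENNReal.ofReal
      (inner ℂ (b i) (negPartOfShiftedInverse h.choose.1 h.choose.2 (b i))).re
  else ⊤

end NegPart

/-! ### The operator `H_B + V` -/

/-- The Euclidean plane. -/
abbrev Plane : Type := EuclideanSpace ℝ (Fin 2)

/-- The complex Hilbert space `L²(ℝ²)`. -/
abbrev L2Plane : Type := Lp ℂ 2 (volume : Measure Plane)

/-- The vector potential `(B x₂ / 2, - B x₁ / 2)` (coordinates are numbered `0`, `1`). -/
def landauPotential (B : ℝ) (x : Plane) : Fin 2 → ℝ :=
  ![B * x 1 / 2, -(B * x 0 / 2)]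

/-- The first order operators `-i ∂₁ + B x₂ / 2` and `-i ∂₂ - B x₁ / 2` on smooth functions. -/
def magDeriv (B : ℝ) (j : Fin 2) (φ : Plane → ℂ) (x : Plane) : ℂ :=
  -Complex.I * fderiv ℝ φ x (EuclideanSpace.single j 1) + (landauPotential B x j : ℂ) * φ x

/-- `g` is the `j`-th magnetic derivative of `u` in the sense of distributions. -/
def IsWeakMagDeriv (B : ℝ) (j : Fin 2) (u g : L2Plane) : Prop :=
  ∀ φ : Plane → ℂ, ContDiff ℝ ∞ φ → HasCompactSupport φ →
    ∫ x, conj (magDeriv B j φ x) * u x = ∫ x, conj (φ x) * g x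

open Classical in
/-- The (unique) weak magnetic derivative in `L²(ℝ²)`, where it exists. -/
def weakMagDeriv (B : ℝ) (j : Fin 2) (u : L2Plane) : L2Plane :=
  if h : ∃ g, IsWeakMagDeriv B j u g then h.choose else 0

/-- The form domain of `H_B + V`: all `u ∈ L²(ℝ²)` whose weak magnetic derivatives are in
`L²(ℝ²)` and for which `∫ |V| |u|² < ∞`. -/
def formDomain (B : ℝ) (V : Plane → ℝ) : Set L2Plane :=
  {u | (∀ j, ∃ g, IsWeakMagDeriv B j u g) ∧ Integrable (fun x => V x * ‖u x‖ ^ 2) volume}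

/-- The sesquilinear form of `H_B + V`. -/
def landauForm (B : ℝ) (V : Plane → ℝ) (v u : L2Plane) : ℂ :=
  ∑ j, inner ℂ (weakMagDeriv B j v) (weakMagDeriv B j u) +
    ∫ x, (V x : ℂ) * (conj (v x) * u x)

/-- The graph of `H_B + V`, the operator of the form `landauForm B V` on `formDomain B V`:
`(H_B + V) u = f` when `u` is in the form domain and the form of `v` and `u` is `⟪v, f⟫` for all
`v` in the form domain. -/
def landauGraph (B : ℝ) (V : Plane → ℝ) : Set (L2Plane × L2Plane) :=
  {p | p.1 ∈ formDomain B V ∧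
    ∀ v ∈ formDomain B V, landauForm B V v p.1 = inner ℂ v p.2}

end

/-!
Let `ψ` be a finite Bessel family in the form domain with magnetic derivatives `g = (g₁, g₂)`, and
`ρ = ∑ |ψ i|²`. The `m`-th Landau level has an explicit orthonormal basis of complex Hermite
functions, and the sum of their squared moduli is the constant `B / 2π`. Splitting `ψ` at level `K`,
Bessel's inequality bounds the low part of `ρ(x)` by `K B / 2π`, while the energy of the high part
is bounded from below level by level; the triangle inequality in `ℓ²` then yields a pointwise lower
bound on the energy density in terms of `ρ(x)`. A scalar Legendre-type inequality turns it into
`-∑ ⟨ψ i, (H_B + V) ψ i⟩ ≤ 3 (B / 2π) ∑ₘ ∫ ((2m + 1) B + V)₋`.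

Applied to single functions and the potential `2V + B`, the same inequality gives a form bound on
`V₋`, so the form is closed and bounded from below, which is where self-adjointness comes from.
Finally, smoothed spectral projections onto the negative axis map an orthonormal family to a Bessel
family in the operator domain, which transfers the variational inequality to the trace.
-/

/-! ### The scalar inequality -/

lemma sqrt_add_sqrt_succ_le {x : ℝ} (hx : 0 ≤ x) :
    (√x + √(x + 1)) / 2 ≤ 2 / 3 * (√(x + 1) ^ 3 - √x ^ 3) := by
  set p := √x
  set q := √(x + 1)
  have hp : p ^ 2 = x := Real.sq_sqrt hx
  have hq : q ^ 2 = x + 1 := Real.sq_sqrt (by linarith)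
  have hp0 : 0 ≤ p := Real.sqrt_nonneg _
  have hq0 : 0 < q := Real.sqrt_pos.2 (by linarith)
  have hpq : (q - p) * (q + p) = 1 := by linear_combination hq - hp
  refine le_of_mul_le_mul_left ?_ (show 0 < q + p by linarith)
  calc (q + p) * ((p + q) / 2) ≤ 2 / 3 * (q ^ 2 + p * q + p ^ 2) := by
        nlinarith [sq_nonneg (p - q)]
    _ = (q + p) * (2 / 3 * (q ^ 3 - p ^ 3)) := by
        linear_combination (-2 / 3 * (q ^ 2 + p * q + p ^ 2)) * hpq

lemma sum_sqrt_succ_le {N : ℕ} (hN : 1 ≤ N) :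
    ∑ n ∈ Finset.range N, √((n : ℝ) + 1) ≤ 2 / 3 * √N ^ 3 + √N / 2 - 1 / 6 := by
  induction N, hN using Nat.le_induction with
  | base => norm_num
  | succ N _ ih =>
    have hstep := sqrt_add_sqrt_succ_le (Nat.cast_nonneg (α := ℝ) N)
    rw [Finset.sum_range_succ]
    push_cast
    linarith

/-- The function `(√ρ - √a)₊²`, a lower bound for the squared distance between two families of
functions with densities `ρ` and at most `a`. -/
noncomputable def densityGap (a ρ : ℝ) : ℝ :=
  max (√ρ - √a) 0 ^ 2

lemma densityGap_nonneg (a ρ : ℝ) : 0 ≤ densityGap a ρ := by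
  unfold densityGap; positivity

/-- The sum `∑ (√r - √n)₊²` over `n = 1, …, N`: the cost, in units of `B / 2π`, of a density `r`
relative to the densities of the first `N` filled Landau levels. -/
noncomputable def sqrtGapSum (N : ℕ) (r : ℝ) : ℝ :=
  ∑ n ∈ Finset.range N, densityGap (n + 1) r

lemma sqrtGapSum_nonneg (N : ℕ) (r : ℝ) : 0 ≤ sqrtGapSum N r :=
  Finset.sum_nonneg fun _ _ => densityGap_nonneg _ _

lemma sqrtGapSum_mono {N M : ℕ} (h : N ≤ M) (r : ℝ) : sqrtGapSum N r ≤ sqrtGapSum M r :=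
  Finset.sum_le_sum_of_subset_of_nonneg (Finset.range_mono h) fun _ _ _ => densityGap_nonneg _ _

lemma sqrtGapSum_eq {N : ℕ} {r : ℝ} (hN : N ≤ r) :
    sqrtGapSum N r =
      N * r - 2 * √r * ∑ n ∈ Finset.range N, √((n : ℝ) + 1) + N * (N + 1) / 2 := by
  have hgauss : ∑ n ∈ Finset.range N, ((n : ℝ) + 1) = N * (N + 1) / 2 := by
    clear hN
    induction N with
    | zero => simp
    | succ N ih => rw [Finset.sum_range_succ, ih]; push_cast; ring
  have hterm : ∀ n ∈ Finset.range N, densityGap (n + 1) r =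
      r - 2 * √r * √((n : ℝ) + 1) + (n + 1) := by
    intro n hn
    have hnr : (n : ℝ) + 1 ≤ r := le_trans (by exact_mod_cast Finset.mem_range.1 hn) hN
    rw [densityGap, max_eq_left (sub_nonneg.2 (Real.sqrt_le_sqrt hnr)), sub_sq,
      Real.sq_sqrt ((Nat.cast_nonneg N).trans hN), Real.sq_sqrt (by positivity)]
  rw [sqrtGapSum, Finset.sum_congr rfl hterm, Finset.sum_add_distrib, Finset.sum_sub_distrib,
    ← Finset.mul_sum, hgauss]
  simp

lemma sqrtGapSum_floor_ge {r : ℝ} (hr : 3 ≤ r) :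
    r ^ 2 / 6 - r / 2 + 3 / 8 ≤ sqrtGapSum ⌊r⌋₊ r := by
  have hNr : (⌊r⌋₊ : ℝ) ≤ r := Nat.floor_le (by linarith)
  have hsum := sum_sqrt_succ_le (N := ⌊r⌋₊) (Nat.le_floor (by push_cast; linarith))
  rw [sqrtGapSum_eq hNr]
  set s := √r
  set p := √(⌊r⌋₊ : ℝ)
  have hs2 : s ^ 2 = r := Real.sq_sqrt (by linarith)
  have hp2 : p ^ 2 = ⌊r⌋₊ := Real.sq_sqrt (by positivity)
  have hp0 : 0 ≤ p := Real.sqrt_nonneg _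
  have hps : p ≤ s := Real.sqrt_le_sqrt hNr
  have hs : 9 / 8 ≤ s := Real.le_sqrt_of_sq_le (by norm_num; linarith)
  have hgap : (s - p) * (s + p) ≤ 1 := by nlinarith [Nat.lt_floor_add_one r]
  have hcube : (s - p) ^ 3 * (s + 3 * p) ≤ 3 * (s - p) ^ 2 := by
    calc (s - p) ^ 3 * (s + 3 * p) = (s - p) ^ 2 * ((s - p) * (s + 3 * p)) := by ring
      _ ≤ (s - p) ^ 2 * 3 := by gcongr; nlinarith [hp0]
      _ = 3 * (s - p) ^ 2 := by ring
  calc r ^ 2 / 6 - r / 2 + 3 / 8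
      ≤ p ^ 2 * s ^ 2 - 2 * s * (2 / 3 * p ^ 3 + p / 2 - 1 / 6) + p ^ 2 * (p ^ 2 + 1) / 2 := by
        rw [← hs2]; linear_combination hcube / 6 + hs / 3
    _ ≤ _ := by rw [hp2, hs2]; gcongr

lemma le_sqrtGapSum_floor (r : ℝ) (k : ℕ) :
    k * r - 3 / 2 * (k * (k + 1)) ≤ sqrtGapSum ⌊r⌋₊ r := by
  rcases le_total 3 r with hr | hr
  · refine le_trans ?_ (sqrtGapSum_floor_ge hr)
    linear_combination sq_nonneg (r - 3 * (k + 1 / 2)) / 6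
  · refine le_trans ?_ (sqrtGapSum_nonneg _ _)
    rcases Nat.eq_zero_or_pos k with rfl | hk
    · simp
    · have hk1 : (1 : ℝ) ≤ k := by exact_mod_cast hk
      nlinarith

lemma sum_sub_odd (n : ℕ) (y : ℝ) :
    ∑ m ∈ Finset.range n, (y - (2 * m + 1)) = n * (y - n) := by
  induction n with
  | zero => simp
  | succ n ih => rw [Finset.sum_range_succ, ih]; push_cast; ring

/-- The pointwise inequality behind the Lieb–Thirring bound, in units where the levels are the odd
numbers. With `y = 2 (k + θ) + 1` it interpolates `le_sqrtGapSum_floor` between `k` and `k + 1`. -/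
lemma exists_mul_le_add_sqrtGapSum {y r : ℝ} (hr : 0 ≤ r) : ∃ N : ℕ,
    y * r ≤ r + 2 * sqrtGapSum N r + 3 * ∑ m ∈ Finset.range N, max (y - (2 * m + 1)) 0 := by
  rcases le_total y 1 with hy | hy
  · refine ⟨0, ?_⟩
    simp only [sqrtGapSum, Finset.range_zero, Finset.sum_empty]
    nlinarith
  obtain ⟨k, θ, hθ0, hθ1, rfl⟩ :
      ∃ (k : ℕ) (θ : ℝ), 0 ≤ θ ∧ 0 ≤ 1 - θ ∧ y = 2 * (k + θ) + 1 := by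
    refine ⟨⌊(y - 1) / 2⌋₊, (y - 1) / 2 - ⌊(y - 1) / 2⌋₊, ?_, ?_, by ring⟩
    · linarith [Nat.floor_le (show 0 ≤ (y - 1) / 2 by linarith)]
    · linarith [Nat.lt_floor_add_one ((y - 1) / 2)]
  refine ⟨max ⌊r⌋₊ (k + 1), ?_⟩
  have hlevels : (k + 1) * (k + 2 * θ) ≤
      ∑ m ∈ Finset.range (max ⌊r⌋₊ (k + 1)), max (2 * (k + θ) + 1 - (2 * m + 1)) 0 :=
    calc (k + 1) * (k + 2 * θ)
        = ∑ m ∈ Finset.range (k + 1), (2 * (k + θ) + 1 - (2 * m + 1)) := by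
          rw [sum_sub_odd]; push_cast; ring
      _ ≤ ∑ m ∈ Finset.range (k + 1), max (2 * (k + θ) + 1 - (2 * m + 1)) 0 :=
          Finset.sum_le_sum fun _ _ => le_max_left _ _
      _ ≤ _ := Finset.sum_le_sum_of_subset_of_nonneg (Finset.range_mono (le_max_right _ _))
          fun _ _ _ => le_max_right _ _
  have hgap : (k + θ) * r - 3 / 2 * ((k + 1) * (k + 2 * θ)) ≤ sqrtGapSum ⌊r⌋₊ r := by
    have hk := mul_le_mul_of_nonneg_left (le_sqrtGapSum_floor r k) hθ1
    have hk1 := mul_le_mul_of_nonneg_left (le_sqrtGapSum_floor r (k + 1)) hθ0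
    push_cast at hk1
    linear_combination hk + hk1
  linear_combination 2 * hgap + 3 * hlevels + 2 * sqrtGapSum_mono (le_max_left ⌊r⌋₊ (k + 1)) r

/-! ### Complex Hermite polynomials -/

/-- The complex Hermite polynomials
`H m k w = ∑ j, (-1)^j j! (m choose j) (k choose j) (conj w)^(m-j) w^(k-j)`; the truncated
index `k - 1` is harmless because of the factor `k`. -/
noncomputable def complexHermite : ℕ → ℕ → ℂ → ℂ
  | 0, k, w => w ^ k
  | m + 1, k, w => conj w * complexHermite m k w - k * complexHermite m (k - 1) w

section ComplexHermite

variable (m k : ℕ) (w : ℂ)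

lemma complexHermite_zero : complexHermite 0 k w = w ^ k := by
  rw [complexHermite]

lemma complexHermite_succ : complexHermite (m + 1) k w =
    conj w * complexHermite m k w - k * complexHermite m (k - 1) w := by
  rw [complexHermite]

lemma complexHermite_zero_right : complexHermite m 0 w = conj w ^ m := by
  induction m with
  | zero => simp [complexHermite_zero]
  | succ m ih => rw [complexHermite_succ, ih]; push_cast; ring

lemma natCast_mul_complexHermite : (m : ℂ) * complexHermite m k w =
    m * (conj w * complexHermite (m - 1) k w - k * complexHermite (m - 1) (k - 1) w) := by
  cases m with
  | zero => simp
  | succ m => rw [complexHermite_succ, Nat.add_sub_cancel]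

lemma complexHermite_succ_right : complexHermite m (k + 1) w =
    w * complexHermite m k w - m * complexHermite (m - 1) k w := by
  induction m generalizing k with
  | zero => simp [complexHermite_zero, pow_succ, mul_comm]
  | succ m ih =>
    have hk : (k : ℂ) * complexHermite m k w = k * (w * complexHermite m (k - 1) w -
        m * complexHermite (m - 1) (k - 1) w) := by
      cases k with
      | zero => simp
      | succ k => rw [ih, Nat.add_sub_cancel]
    rw [complexHermite_succ, complexHermite_succ m k, ih]
    simp only [Nat.add_sub_cancel]
    push_cast
    linear_combination natCast_mul_complexHermite m k w - hk

lemma conj_complexHermite : conj (complexHermite m k w) = complexHermite k m w := by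
  induction m generalizing k with
  | zero => simp [complexHermite_zero, complexHermite_zero_right]
  | succ m ih => rw [complexHermite_succ, complexHermite_succ_right, ← ih, ← ih]; simp

lemma conj_mul_complexHermite : conj w * complexHermite m k w =
    complexHermite (m + 1) k w + k * complexHermite m (k - 1) w := by
  rw [complexHermite_succ]; ring

lemma mul_complexHermite : w * complexHermite m k w =
    complexHermite m (k + 1) w + m * complexHermite (m - 1) k w := by
  rw [complexHermite_succ_right]; ring

lemma hasFDerivAt_complexHermite : HasFDerivAt (complexHermite m k)
    ((k * complexHermite m (k - 1) w) • ContinuousLinearMap.id ℝ ℂ +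
      (m * complexHermite (m - 1) k w) • (Complex.conjCLE : ℂ →L[ℝ] ℂ)) w := by
  induction m generalizing k with
  | zero =>
    rw [show complexHermite 0 k = fun w => w ^ k from funext (complexHermite_zero k)]
    refine ((hasDerivAt_pow k w).hasFDerivAt.restrictScalars ℝ).congr_fderiv ?_
    ext v
    simp [complexHermite_zero, mul_comm]
  | succ m ih =>
    rw [show complexHermite (m + 1) k = fun w => (Complex.conjCLE : ℂ →L[ℝ] ℂ) w *
        complexHermite m k w - k * complexHermite m (k - 1) w from
      funext (complexHermite_succ m k)]
    refine ((((Complex.conjCLE : ℂ →L[ℝ] ℂ).hasFDerivAt (x := w)).mul (ih k)).sub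
      ((ih (k - 1)).const_mul (k : ℂ))).congr_fderiv ?_
    ext v
    simp only [sub_apply, add_apply, smul_apply, ContinuousLinearMap.id_apply, smul_eq_mul,
      ContinuousLinearEquiv.coe_coe, Complex.conjCLE_apply, Nat.add_sub_cancel,
      complexHermite_succ m (k - 1)]
    push_cast
    linear_combination (-conj v) * natCast_mul_complexHermite m k w

lemma contDiff_complexHermite {n : WithTop ℕ∞} : ContDiff ℝ n (complexHermite m k) := by
  induction m generalizing k with
  | zero =>
    rw [show complexHermite 0 k = fun w => w ^ k from funext (complexHermite_zero k)]
    exact contDiff_id.pow k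
  | succ m ih =>
    rw [show complexHermite (m + 1) k = fun w => Complex.conjCLE w * complexHermite m k w -
        k * complexHermite m (k - 1) w from funext (complexHermite_succ m k)]
    exact (Complex.conjCLE.contDiff.mul (ih k)).sub (contDiff_const.mul (ih (k - 1)))

lemma norm_complexHermite_le :
    ‖complexHermite m k w‖ ≤ (1 + ‖w‖) ^ m * (2 ^ m * (1 + ‖w‖)) ^ k := by
  induction m generalizing k with
  | zero =>
    rw [complexHermite_zero, norm_pow, pow_zero, one_mul, pow_zero, one_mul]
    gcongr
    linarith
  | succ m ih =>
    have hw := norm_nonneg w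
    set R := 1 + ‖w‖
    have hR : 1 ≤ R := by linarith
    have hmR : (1 : ℝ) ≤ 2 ^ m * R := one_le_mul_of_one_le_of_one_le (one_le_pow₀ one_le_two) hR
    have hk : R + k ≤ R * 2 ^ k := by
      have : (k : ℝ) + 1 ≤ 2 ^ k := by exact_mod_cast Nat.lt_two_pow_self
      nlinarith
    rw [complexHermite_succ]
    calc ‖conj w * complexHermite m k w - k * complexHermite m (k - 1) w‖
        ≤ ‖w‖ * ‖complexHermite m k w‖ + k * ‖complexHermite m (k - 1) w‖ := by
          simpa using norm_sub_le (conj w * complexHermite m k w)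
            (k * complexHermite m (k - 1) w)
      _ ≤ R * (R ^ m * (2 ^ m * R) ^ k) + k * (R ^ m * (2 ^ m * R) ^ k) := by
          gcongr
          · linarith
          · exact ih k
          · refine (ih (k - 1)).trans ?_
            gcongr
            exact Nat.sub_le k 1
      _ = (R + k) * (R ^ m * (2 ^ m * R) ^ k) := by ring
      _ ≤ (R * 2 ^ k) * (R ^ m * (2 ^ m * R) ^ k) := by gcongr
      _ = R ^ (m + 1) * (2 ^ (m + 1) * R) ^ k := by
          rw [pow_succ, pow_succ, mul_pow, mul_pow, mul_pow]; ring

variable (m' : ℕ)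

lemma summable_complexHermite : Summable fun k : ℕ =>
    complexHermite m k w * conj (complexHermite m' k w) / k.factorial := by
  set R := 1 + ‖w‖
  refine Summable.of_norm_bounded (g := fun k : ℕ => R ^ m * R ^ m' *
    (((2 ^ m * R) * (2 ^ m' * R)) ^ k / k.factorial))
    ((Real.summable_pow_div_factorial _).mul_left _) fun k => ?_
  rw [norm_div, norm_mul, RCLike.norm_conj, Complex.norm_natCast]
  calc _ ≤ (R ^ m * (2 ^ m * R) ^ k) * (R ^ m' * (2 ^ m' * R) ^ k) / k.factorial := by
        gcongr
        · exact norm_complexHermite_le m k w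
        · exact norm_complexHermite_le m' k w
    _ = _ := by rw [mul_pow (2 ^ m * R)]; ring

/-- For the pairing by the sum over `k`, raising the first index is adjoint to lowering it. -/
lemma tsum_complexHermite_succ :
    ∑' k : ℕ, complexHermite (m + 1) k w * conj (complexHermite m' k w) / k.factorial =
      m' * ∑' k : ℕ, complexHermite m k w * conj (complexHermite (m' - 1) k w) / k.factorial := by
  set S := fun a b : ℕ =>
    ∑' k : ℕ, complexHermite a k w * conj (complexHermite b k w) / k.factorial
  have hsum (a b : ℕ) : HasSum _ (S a b) := (summable_complexHermite a w b).hasSum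
  have hshift : HasSum (fun k : ℕ => k * complexHermite m (k - 1) w *
      conj (complexHermite m' k w) / k.factorial) (conj w * S m m' - m' * S m (m' - 1)) := by
    rw [← hasSum_nat_add_iff' 1]
    simp only [Finset.range_one, Finset.sum_singleton, Nat.cast_zero, zero_mul, zero_div, sub_zero]
    refine (((hsum m m').mul_left (conj w)).sub
      ((hsum m (m' - 1)).mul_left (m' : ℂ))).congr_fun fun k => ?_
    have hk : (k : ℂ) + 1 ≠ 0 := by exact_mod_cast Nat.succ_ne_zero k
    rw [Nat.factorial_succ, Nat.add_sub_cancel, complexHermite_succ_right, map_sub, map_mul,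
      map_mul, map_natCast]
    push_cast
    field_simp
  have hdiff := ((hsum m m').mul_left (conj w)).sub hshift
  rw [sub_sub_cancel] at hdiff
  refine HasSum.tsum_eq (hdiff.congr_fun fun k => ?_)
  rw [complexHermite_succ]
  ring

lemma mul_conj_complexHermite_div :
    complexHermite m k w * conj (complexHermite m k w) / k.factorial =
      ((‖complexHermite m k w‖ ^ 2 / k.factorial : ℝ) : ℂ) := by
  rw [Complex.mul_conj, Complex.normSq_eq_norm_sq]
  norm_cast

lemma tsum_complexHermite_self :
    ∑' k : ℕ, complexHermite m k w * conj (complexHermite m k w) / k.factorial =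
      m.factorial * Real.exp (‖w‖ ^ 2) := by
  induction m with
  | zero =>
    simp_rw [mul_conj_complexHermite_div, complexHermite_zero, norm_pow, ← pow_mul,
      mul_comm _ 2, pow_mul]
    rw [← Complex.ofReal_tsum, Real.exp_eq_exp_ℝ, NormedSpace.exp_eq_tsum_div]
    simp
  | succ m ih =>
    rw [tsum_complexHermite_succ, Nat.add_sub_cancel, ih, Nat.factorial_succ]
    push_cast
    ring

lemma hasSum_norm_complexHermite :
    HasSum (fun k : ℕ => ‖complexHermite m k w‖ ^ 2 / k.factorial)
      (m.factorial * Real.exp (‖w‖ ^ 2)) := by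
  have h := (summable_complexHermite m w m).hasSum
  rw [tsum_complexHermite_self] at h
  simp_rw [mul_conj_complexHermite_div] at h
  exact_mod_cast h

end ComplexHermite

/-! ### Functions dominated by a Gaussian -/

lemma exp_linear_sub_sq_le {a : ℝ} (ha : 0 < a) (κ t : ℝ) :
    Real.exp (κ * t - a * t ^ 2) ≤ Real.exp (κ ^ 2 / (2 * a)) * Real.exp (-(a / 2) * t ^ 2) := by
  rw [← Real.exp_add, Real.exp_le_exp, ← sub_nonneg]
  have hsq : κ ^ 2 / (2 * a) + -(a / 2) * t ^ 2 - (κ * t - a * t ^ 2) =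
      (κ - a * t) ^ 2 / (2 * a) := by
    field_simp
    ring
  rw [hsq]
  positivity

section GaussianBound

variable {F E : Type*} [NormedAddCommGroup F] [InnerProductSpace ℝ F] [FiniteDimensional ℝ F]
  [MeasurableSpace F] [BorelSpace F] [NormedAddCommGroup E]

lemma integrable_exp_neg_mul_sq_norm {a : ℝ} (ha : 0 < a) :
    Integrable fun x : F => Real.exp (-a * ‖x‖ ^ 2) := by
  have h := (GaussianFourier.integrable_cexp_neg_mul_sq_norm_add (V := F) (b := (a : ℂ))
    (by simpa using ha) 0 0).norm
  refine h.congr (Filter.Eventually.of_forall fun x => ?_)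
  simp only [zero_mul, add_zero, Complex.norm_exp]
  norm_cast

lemma integrable_of_norm_le_exp {a C κ : ℝ} (ha : 0 < a) {f : F → E}
    (hf : AEStronglyMeasurable f volume)
    (h : ∀ᵐ x, ‖f x‖ ≤ C * Real.exp (κ * ‖x‖ - a * ‖x‖ ^ 2)) : Integrable f volume := by
  refine Integrable.mono' (((integrable_exp_neg_mul_sq_norm (half_pos ha)).const_mul
    (Real.exp (κ ^ 2 / (2 * a)))).const_mul |C|) hf ?_
  filter_upwards [h] with x hx
  exact hx.trans (mul_le_mul (le_abs_self C) (exp_linear_sub_sq_le ha κ _) (Real.exp_pos _).le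
    (abs_nonneg C))

lemma memLp_two_of_norm_le_exp {a C κ : ℝ} (ha : 0 < a) {f : F → E}
    (hf : AEStronglyMeasurable f volume)
    (h : ∀ x, ‖f x‖ ≤ C * Real.exp (κ * ‖x‖ - a * ‖x‖ ^ 2)) : MemLp f 2 volume := by
  rw [memLp_two_iff_integrable_sq_norm hf]
  refine integrable_of_norm_le_exp (a := 2 * a) (C := C ^ 2) (κ := 2 * κ) (by positivity)
    (hf.norm.pow 2) (Filter.Eventually.of_forall fun x => ?_)
  rw [Real.norm_of_nonneg (by positivity)]
  calc ‖f x‖ ^ 2 ≤ (C * Real.exp (κ * ‖x‖ - a * ‖x‖ ^ 2)) ^ 2 := by gcongr; exact h x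
    _ = _ := by rw [mul_pow, ← Real.exp_nat_mul]; congr 2; push_cast; ring

end GaussianBound

/-! ### The Landau functions -/

/-- The complex coordinate `√(B/2) (x₁ + i x₂)`. -/
noncomputable def landauCoord (B : ℝ) : Plane →L[ℝ] ℂ :=
  (√(B / 2) : ℝ) • (Complex.ofRealCLM ∘L EuclideanSpace.proj 0 +
    Complex.I • (Complex.ofRealCLM ∘L EuclideanSpace.proj 1))

/-- The coefficients with which the creation operator of the Landau levels enters the two magnetic
derivatives. -/
noncomputable def ladderPhase : Fin 2 → ℂ := ![Complex.I, -1]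

/-- The unnormalized Landau functions: complex Hermite polynomials times a Gaussian. -/
noncomputable def landauFun (B : ℝ) (m k : ℕ) (x : Plane) : ℂ :=
  complexHermite m k (landauCoord B x) * (Real.exp (-(B / 4) * ‖x‖ ^ 2) : ℝ)

section LandauFunctions

variable {B : ℝ}

lemma landauCoord_apply (B : ℝ) (x : Plane) :
    landauCoord B x = (√(B / 2) : ℝ) * ((x 0 : ℂ) + Complex.I * (x 1 : ℂ)) := by
  simp [landauCoord, mul_add]

lemma conj_landauCoord (B : ℝ) (x : Plane) :
    conj (landauCoord B x) = (√(B / 2) : ℝ) * ((x 0 : ℂ) - Complex.I * (x 1 : ℂ)) := by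
  rw [landauCoord_apply]; simp [mul_add, sub_eq_add_neg]

lemma landauCoord_single (B : ℝ) (j : Fin 2) :
    landauCoord B (EuclideanSpace.single j 1) = -Complex.I * (√(B / 2) : ℝ) * ladderPhase j := by
  rw [landauCoord_apply]
  generalize √(B / 2) = s
  fin_cases j
  · suffices (s : ℂ) = -(Complex.I * s * Complex.I) by simpa [ladderPhase] using this
    linear_combination (s : ℂ) * Complex.I_sq
  · simp [ladderPhase, mul_comm]

lemma norm_landauCoord (B : ℝ) (x : Plane) : ‖landauCoord B x‖ = √(B / 2) * ‖x‖ := by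
  have hnorm : ‖(x 0 : ℂ) + Complex.I * (x 1 : ℂ)‖ = ‖x‖ := by
    rw [mul_comm, Complex.norm_add_mul_I, EuclideanSpace.norm_eq]
    simp [Fin.sum_univ_two]
  rw [landauCoord_apply, norm_mul, hnorm, Complex.norm_real,
    Real.norm_of_nonneg (Real.sqrt_nonneg _)]

lemma landauPotential_add_eq (hB : 0 ≤ B) (x : Plane) (j : Fin 2) :
    (landauPotential B x j : ℂ) + Complex.I * (B / 2 * x j : ℝ) =
      (√(B / 2) : ℝ) * ladderPhase j * conj (landauCoord B x) := by
  have hsqrt : ((√(B / 2) : ℝ) : ℂ) ^ 2 = (B : ℂ) / 2 := by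
    rw [← Complex.ofReal_pow, Real.sq_sqrt (by positivity)]; push_cast; rfl
  rw [conj_landauCoord]
  generalize √(B / 2) = s at hsqrt ⊢
  fin_cases j
  · simp only [landauPotential, ladderPhase, Fin.zero_eta, Matrix.cons_val_zero]
    push_cast
    linear_combination (Complex.I ^ 2 * x 1 - Complex.I * x 0) * hsqrt + B / 2 * x 1 * Complex.I_sq
  · simp only [landauPotential, ladderPhase, Fin.mk_one, Matrix.cons_val_one,
      Matrix.cons_val_fin_one]
    push_cast
    linear_combination (x 0 - Complex.I * x 1) * hsqrt

variable (B) (m k : ℕ)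

lemma contDiff_landauFun {n : WithTop ℕ∞} : ContDiff ℝ n (landauFun B m k) := by
  have hgauss : ContDiff ℝ n fun x : Plane => ((Real.exp (-(B / 4) * ‖x‖ ^ 2) : ℝ) : ℂ) :=
    Complex.ofRealCLM.contDiff.comp
      (Real.contDiff_exp.comp (contDiff_const.mul (contDiff_norm_sq ℝ)))
  exact ((contDiff_complexHermite m k).comp (landauCoord B).contDiff).mul hgauss

lemma continuous_landauFun : Continuous (landauFun B m k) :=
  (contDiff_landauFun B m k (n := 0)).continuous

lemma conj_landauFun (x : Plane) : conj (landauFun B m k x) = landauFun B k m x := by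
  rw [landauFun, map_mul, Complex.conj_ofReal, conj_complexHermite, landauFun]

variable {B}

lemma magDeriv_landauFun (hB : 0 ≤ B) (j : Fin 2) (x : Plane) :
    magDeriv B j (landauFun B m k) x = (√(B / 2) : ℝ) *
      (ladderPhase j * landauFun B (m + 1) k x +
        m * conj (ladderPhase j) * landauFun B (m - 1) k x) := by
  have hgauss := (Complex.ofRealCLM.hasFDerivAt (x := Real.exp (-(B / 4) * ‖x‖ ^ 2))).comp x
    (((hasStrictFDerivAt_norm_sq x).hasFDerivAt.const_mul (-(B / 4))).exp)
  have hfun : HasFDerivAt (landauFun B m k) _ x :=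
    ((hasFDerivAt_complexHermite m k (landauCoord B x)).comp x
      (landauCoord B).hasFDerivAt).mul hgauss
  rw [magDeriv, hfun.fderiv]
  simp only [add_apply, smul_apply, ContinuousLinearMap.comp_apply, smul_eq_mul,
    ContinuousLinearMap.id_apply, ContinuousLinearEquiv.coe_coe, Complex.conjCLE_apply,
    Function.comp_apply, innerSL_apply_apply, Complex.ofRealCLM_apply,
    EuclideanSpace.inner_single_right, landauCoord_single, landauFun, complexHermite_succ,
    map_mul, map_neg, Complex.conj_I, Complex.conj_ofReal]
  have hpot := landauPotential_add_eq hB x j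
  generalize √(B / 2) = s at hpot ⊢
  generalize Real.exp (-(B / 4) * ‖x‖ ^ 2) = g
  simp only [RCLike.conj_to_real, one_mul, nsmul_eq_mul, Complex.ofReal_mul]
  push_cast at hpot ⊢
  linear_combination (complexHermite m k (landauCoord B x) * g) * hpot +
    (k * complexHermite m (k - 1) (landauCoord B x) * ladderPhase j -
      m * complexHermite (m - 1) k (landauCoord B x) * conj (ladderPhase j)) * s * g * Complex.I_sq

lemma norm_landauFun_le (B : ℝ) (m k : ℕ) : ∃ C κ : ℝ, ∀ x,
    ‖landauFun B m k x‖ ≤ C * Real.exp (κ * ‖x‖ - B / 4 * ‖x‖ ^ 2) := by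
  set s := √(B / 2) with hs
  refine ⟨(2 ^ m) ^ k * ((m + k).factorial * Real.exp 1), s, fun x => ?_⟩
  have hsx : 0 ≤ s * ‖x‖ := by positivity
  have hpoly := norm_complexHermite_le m k (landauCoord B x)
  have hexp := Real.pow_div_factorial_le_exp (1 + s * ‖x‖) (by linarith only [hsx]) (m + k)
  rw [div_le_iff₀' (by positivity)] at hexp
  rw [norm_landauCoord, ← hs] at hpoly
  rw [landauFun, norm_mul, Complex.norm_real, Real.norm_of_nonneg (Real.exp_pos _).le]
  calc _ ≤ ((1 + s * ‖x‖) ^ m * (2 ^ m * (1 + s * ‖x‖)) ^ k) *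
        Real.exp (-(B / 4) * ‖x‖ ^ 2) := by gcongr
    _ = (2 ^ m) ^ k * (1 + s * ‖x‖) ^ (m + k) * Real.exp (-(B / 4) * ‖x‖ ^ 2) := by
        rw [mul_pow, pow_add]; ring
    _ ≤ (2 ^ m) ^ k * ((m + k).factorial * Real.exp (1 + s * ‖x‖)) *
          Real.exp (-(B / 4) * ‖x‖ ^ 2) := by gcongr
    _ = _ := by
        rw [Real.exp_add, sub_eq_add_neg, Real.exp_add, neg_mul]; ring

lemma memLp_landauFun (hB : 0 < B) : MemLp (landauFun B m k) 2 volume := by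
  obtain ⟨C, κ, h⟩ := norm_landauFun_le B m k
  exact memLp_two_of_norm_le_exp (by positivity)
    (continuous_landauFun B m k).aestronglyMeasurable h

lemma memLp_magDeriv_landauFun (hB : 0 < B) (j : Fin 2) :
    MemLp (magDeriv B j (landauFun B m k)) 2 volume := by
  rw [funext (magDeriv_landauFun m k hB.le j)]
  exact (((memLp_landauFun _ _ hB).const_mul _).add
    ((memLp_landauFun _ _ hB).const_mul _)).const_mul _

end LandauFunctions

/-! ### Testing weak derivatives against square integrable functions -/

lemma integrable_conj_mul {α 𝕜 : Type*} [MeasurableSpace α] {μ : Measure α} [RCLike 𝕜]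
    {f g : α → 𝕜} (hf : MemLp f 2 μ) (hg : MemLp g 2 μ) :
    Integrable (fun x => conj (f x) * g x) μ :=
  MemLp.integrable_mul (f := fun x => conj (f x)) hf.star hg

lemma tendsto_integral_smul_of_bounded {α E : Type*} [MeasurableSpace α] {μ : Measure α}
    [NormedAddCommGroup E] [NormedSpace ℝ E] {a : ℕ → α → ℝ} {C c : ℝ}
    (hmeas : ∀ n, AEStronglyMeasurable (a n) μ) (hbound : ∀ n x, ‖a n x‖ ≤ C)
    (hlim : ∀ x, Filter.Tendsto (a · x) Filter.atTop (nhds c)) {F : α → E} (hF : Integrable F μ) :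
    Filter.Tendsto (fun n => ∫ x, a n x • F x ∂μ) Filter.atTop (nhds (c • ∫ x, F x ∂μ)) := by
  rw [← integral_smul]
  refine tendsto_integral_of_dominated_convergence (fun x => C * ‖F x‖)
    (fun n => (hmeas n).smul hF.1) (hF.norm.const_mul C)
    (fun n => Filter.Eventually.of_forall fun x => ?_)
    (Filter.Eventually.of_forall fun x => (hlim x).smul_const (F x))
  rw [norm_smul]
  exact mul_le_mul_of_nonneg_right (hbound n x) (norm_nonneg _)

/-- The functions are `χ (x / (n + 1))` for a fixed bump function `χ`. -/
lemma exists_smooth_cutoff_seq (E : Type*) [NormedAddCommGroup E] [NormedSpace ℝ E]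
    [FiniteDimensional ℝ E] : ∃ (χ : ℕ → E → ℝ) (C : ℝ),
      (∀ n, ContDiff ℝ ∞ (χ n)) ∧ (∀ n, HasCompactSupport (χ n)) ∧ (∀ n x, ‖χ n x‖ ≤ 1) ∧
      (∀ n x, ‖fderiv ℝ (χ n) x‖ ≤ C) ∧ ∀ x, ∀ᶠ n in Filter.atTop, χ n =ᶠ[nhds x] 1 := by
  let f : ContDiffBump (0 : E) := ⟨1, 2, one_pos, one_lt_two⟩
  have hf : ContDiff ℝ ∞ (f : E → ℝ) := f.contDiff
  obtain ⟨C, hC⟩ : ∃ C, ∀ x, ‖fderiv ℝ f x‖ ≤ C :=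
    (hf.continuous_fderiv (by simp)).bounded_above_of_compact_support
      (f.hasCompactSupport.fderiv (𝕜 := ℝ))
  let c : ℕ → ℝ := fun n => ((n : ℝ) + 1)⁻¹
  have hc0 (n : ℕ) : 0 < c n := by positivity
  refine ⟨fun n x => f (c n • x), C, fun n => hf.comp (contDiff_const_smul (c n)),
    fun n => f.hasCompactSupport.comp_homeomorph (Homeomorph.smulOfNeZero (c n) (hc0 n).ne'),
    fun n x => ?_, fun n x => ?_, fun x => ?_⟩
  · rw [Real.norm_of_nonneg f.nonneg]
    exact f.le_one
  · rw [fderiv_comp_smul, norm_smul, Real.norm_of_nonneg (hc0 n).le]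
    exact (mul_le_of_le_one_left (norm_nonneg _) (inv_le_one_of_one_le₀ (by simp))).trans (hC _)
  · obtain ⟨N, hN⟩ := exists_nat_gt ‖x‖
    filter_upwards [Filter.eventually_ge_atTop N] with n hn
    have hmem : c n • x ∈ Metric.ball (0 : E) 1 := by
      have hNn : (N : ℝ) ≤ n := by exact_mod_cast hn
      rw [mem_ball_zero_iff, norm_smul, Real.norm_of_nonneg (hc0 n).le,
        inv_mul_lt_one₀ (by positivity)]
      linarith
    exact (continuous_const_smul (c n)).continuousAt.eventually
      (f.eventuallyEq_one_of_mem_ball hmem)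

section TestFunctions

variable {B : ℝ} {j : Fin 2} {φ ψ : Plane → ℂ}

lemma magDeriv_ofReal_mul {χ : Plane → ℝ} {x : Plane}
    (hχ : DifferentiableAt ℝ χ x) (hφ : DifferentiableAt ℝ φ x) :
    magDeriv B j (fun y => (χ y : ℂ) * φ y) x = χ x * magDeriv B j φ x -
      Complex.I * (fderiv ℝ χ x (EuclideanSpace.single j 1) : ℝ) * φ x := by
  have hmul : HasFDerivAt (fun y => (χ y : ℂ) * φ y) _ x :=
    (Complex.ofRealCLM.hasFDerivAt.comp x hχ.hasFDerivAt).mul hφ.hasFDerivAt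
  rw [magDeriv, hmul.fderiv, magDeriv]
  simp only [add_apply, smul_apply, ContinuousLinearMap.comp_apply, Complex.ofRealCLM_apply,
    Function.comp_apply, smul_eq_mul]
  ring

lemma continuous_magDeriv (B : ℝ) (j : Fin 2) (hφ : ContDiff ℝ 1 φ) :
    Continuous (magDeriv B j φ) := by
  have hpot : Continuous fun x => landauPotential B x j := by
    fin_cases j
    · change Continuous fun x : Plane => B * x 1 / 2
      fun_prop
    · change Continuous fun x : Plane => -(B * x 0 / 2)
      fun_prop
  have hfderiv : Continuous fun x => fderiv ℝ φ x (EuclideanSpace.single j 1) :=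
    (hφ.continuous_fderiv one_ne_zero).clm_apply continuous_const
  exact (continuous_const.mul hfderiv).add ((Complex.continuous_ofReal.comp hpot).mul hφ.continuous)

lemma hasCompactSupport_magDeriv (B : ℝ) (j : Fin 2) (hφ : HasCompactSupport φ) :
    HasCompactSupport (magDeriv B j φ) :=
  ((hφ.fderiv_apply (𝕜 := ℝ) _).mul_left).add hφ.mul_left

lemma integral_conj_magDeriv_of_hasCompactSupport (B : ℝ) (j : Fin 2)
    (hφ : ContDiff ℝ 1 φ) (hψ : ContDiff ℝ 1 ψ) (hc : HasCompactSupport φ) :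
    ∫ x, conj (magDeriv B j φ x) * ψ x = ∫ x, conj (φ x) * magDeriv B j ψ x := by
  set v : Plane := EuclideanSpace.single j 1
  set f : Plane → ℂ := fun x => conj (φ x)
  have hfc : HasCompactSupport f := hc.comp_left (g := fun z : ℂ => conj z) (map_zero _)
  have hf : ContDiff ℝ 1 f := Complex.conjCLE.contDiff.comp hφ
  have hfderiv (x : Plane) : fderiv ℝ f x v = conj (fderiv ℝ φ x v) := by
    have h : HasFDerivAt f ((Complex.conjCLE : ℂ →L[ℝ] ℂ) ∘L fderiv ℝ φ x) x :=
      (Complex.conjCLE : ℂ →L[ℝ] ℂ).hasFDerivAt.comp x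
        (hφ.differentiable one_ne_zero x).hasFDerivAt
    rw [h.fderiv]
    rfl
  have hderiv_mul : Integrable (fun x => fderiv ℝ f x v * ψ x) volume :=
    (((hf.continuous_fderiv one_ne_zero).clm_apply continuous_const).mul
      hψ.continuous).integrable_of_hasCompactSupport (hfc.fderiv_apply (𝕜 := ℝ) v).mul_right
  have hmul_deriv : Integrable (fun x => f x * fderiv ℝ ψ x v) volume :=
    (hf.continuous.mul ((hψ.continuous_fderiv one_ne_zero).clm_apply
      continuous_const)).integrable_of_hasCompactSupport hfc.mul_right
  have hmul : Integrable (fun x => f x * ψ x) volume :=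
    (hf.continuous.mul hψ.continuous).integrable_of_hasCompactSupport hfc.mul_right
  have hparts := integral_mul_fderiv_eq_neg_fderiv_mul_of_integrable hderiv_mul hmul_deriv hmul
    (fun x _ => hf.differentiable one_ne_zero x) (fun x _ => hψ.differentiable one_ne_zero x)
  have hright : Integrable (fun x => conj (φ x) * magDeriv B j ψ x) volume :=
    (hf.continuous.mul (continuous_magDeriv B j hψ)).integrable_of_hasCompactSupport
      hfc.mul_right
  have hsum : Integrable (fun x => fderiv ℝ f x v * ψ x + f x * fderiv ℝ ψ x v) volume :=
    hderiv_mul.add hmul_deriv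
  have hsplit (x : Plane) : conj (magDeriv B j φ x) * ψ x = conj (φ x) * magDeriv B j ψ x +
      (Complex.I * (fderiv ℝ f x v * ψ x) + Complex.I * (f x * fderiv ℝ ψ x v)) := by
    rw [hfderiv]
    simp only [magDeriv, map_add, map_mul, map_neg, Complex.conj_I, Complex.conj_ofReal, f, v]
    ring
  simp_rw [hsplit, ← mul_add]
  rw [integral_add hright (hsum.const_mul _), integral_const_mul,
    integral_add hderiv_mul hmul_deriv, hparts, add_neg_cancel, mul_zero, add_zero]

/-- Compact support of the test functions in the definition of a weak derivative may be replaced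
by square integrability. -/
theorem integral_conj_magDeriv_of_memLp {u g : Plane → ℂ}
    (hu : MemLp u 2 volume) (hg : MemLp g 2 volume)
    (h : ∀ φ : Plane → ℂ, ContDiff ℝ ∞ φ → HasCompactSupport φ →
      ∫ x, conj (magDeriv B j φ x) * u x = ∫ x, conj (φ x) * g x)
    (hφ : ContDiff ℝ ∞ φ) (hφ2 : MemLp φ 2 volume) (hDφ : MemLp (magDeriv B j φ) 2 volume) :
    ∫ x, conj (magDeriv B j φ x) * u x = ∫ x, conj (φ x) * g x := by
  obtain ⟨χ, C, hχ, hχc, hχ1, hχC, hχlim⟩ := exists_smooth_cutoff_seq Plane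
  set v : Plane := EuclideanSpace.single j 1 with hv
  have hχmeas (n : ℕ) : AEStronglyMeasurable (χ n) volume := (hχ n).continuous.aestronglyMeasurable
  have hdχ (n : ℕ) : Continuous fun x => fderiv ℝ (χ n) x v :=
    ((hχ n).continuous_fderiv (by simp)).clm_apply continuous_const
  have hdχC (n : ℕ) (x : Plane) : ‖fderiv ℝ (χ n) x v‖ ≤ C := by
    simpa [hv] using ((fderiv ℝ (χ n) x).le_opNorm v).trans
      (mul_le_mul_of_nonneg_right (hχC n x) (norm_nonneg v))
  have hχtendsto (x : Plane) : Filter.Tendsto (χ · x) Filter.atTop (nhds 1) :=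
    tendsto_const_nhds.congr' ((hχlim x).mono fun n hn => hn.eq_of_nhds.symm)
  have hdχtendsto (x : Plane) :
      Filter.Tendsto (fun n => fderiv ℝ (χ n) x v) Filter.atTop (nhds 0) :=
    tendsto_const_nhds.congr' ((hχlim x).mono fun n hn => by simp [hn.fderiv_eq])
  have hDφu := integrable_conj_mul hDφ hu
  have hφu := integrable_conj_mul hφ2 hu
  have htest (n : ℕ) : ∫ x, χ n x • (conj (φ x) * g x) =
      (∫ x, χ n x • (conj (magDeriv B j φ x) * u x)) +
        Complex.I * ∫ x, fderiv ℝ (χ n) x v • (conj (φ x) * u x) := by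
    have hn := h (fun y => (χ n y : ℂ) * φ y) ((Complex.ofRealCLM.contDiff.comp (hχ n)).mul hφ)
      (HasCompactSupport.mul_right ((hχc n).comp_left (g := ((↑) : ℝ → ℂ)) Complex.ofReal_zero))
    have hint : Integrable (fun x => χ n x • (conj (magDeriv B j φ x) * u x)) volume :=
      hDφu.bdd_smul 1 (hχmeas n) (Filter.Eventually.of_forall (hχ1 n))
    have hint' : Integrable (fun x => fderiv ℝ (χ n) x v • (conj (φ x) * u x)) volume :=
      hφu.bdd_smul C (hdχ n).aestronglyMeasurable (Filter.Eventually.of_forall (hdχC n))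
    rw [← integral_const_mul, ← integral_add hint (hint'.const_mul _)]
    convert hn.symm using 3 with x x
    · simp only [map_mul, Complex.conj_ofReal, Complex.real_smul]
      ring
    · rw [magDeriv_ofReal_mul ((hχ n).differentiable (by simp) x) (hφ.differentiable (by simp) x)]
      simp only [map_sub, map_mul, Complex.conj_I, Complex.conj_ofReal, Complex.real_smul, v]
      ring
  have hleft := (tendsto_integral_smul_of_bounded hχmeas hχ1 hχtendsto hDφu).add
    ((tendsto_integral_smul_of_bounded (fun n => (hdχ n).aestronglyMeasurable) hdχC hdχtendsto
      hφu).const_mul Complex.I)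
  have hright := tendsto_integral_smul_of_bounded hχmeas hχ1 hχtendsto (integrable_conj_mul hφ2 hg)
  simpa using (tendsto_nhds_unique hright (hleft.congr fun n => (htest n).symm)).symm

lemma integral_conj_magDeriv_symm
    (hφ : ContDiff ℝ ∞ φ) (hφ2 : MemLp φ 2 volume) (hDφ : MemLp (magDeriv B j φ) 2 volume)
    (hψ : ContDiff ℝ 1 ψ) (hψ2 : MemLp ψ 2 volume) (hDψ : MemLp (magDeriv B j ψ) 2 volume) :
    ∫ x, conj (magDeriv B j φ x) * ψ x = ∫ x, conj (φ x) * magDeriv B j ψ x :=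
  integral_conj_magDeriv_of_memLp hψ2 hDψ
    (fun _ h hc => integral_conj_magDeriv_of_hasCompactSupport B j (h.of_le (by simp)) hψ hc)
    hφ hφ2 hDφ

end TestFunctions

/-! ### Orthogonality of the Landau functions -/

section LandauOrthogonality

variable {B : ℝ} (m k m' k' : ℕ)

lemma integrable_conj_landauFun_mul (hB : 0 < B) :
    Integrable (fun x => conj (landauFun B m k x) * landauFun B m' k' x) volume :=
  integrable_conj_mul (memLp_landauFun m k hB) (memLp_landauFun m' k' hB)

lemma integral_conj_landauFun_mul_swap :
    ∫ x, conj (landauFun B m k x) * landauFun B m' k' x =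
      ∫ x, conj (landauFun B k' m' x) * landauFun B k m x := by
  simp only [conj_landauFun, mul_comm]

lemma integral_conj_landauFun_mul_magDeriv (hB : 0 < B) (j : Fin 2) :
    ∫ x, conj (landauFun B m k x) * magDeriv B j (landauFun B m' k') x = (√(B / 2) : ℝ) *
      (ladderPhase j * (∫ x, conj (landauFun B m k x) * landauFun B (m' + 1) k' x) +
        m' * conj (ladderPhase j) *
          ∫ x, conj (landauFun B m k x) * landauFun B (m' - 1) k' x) := by
  rw [← integral_const_mul, ← integral_const_mul, ← integral_add
    ((integrable_conj_landauFun_mul _ _ _ _ hB).const_mul _)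
    ((integrable_conj_landauFun_mul _ _ _ _ hB).const_mul _), ← integral_const_mul]
  refine integral_congr_ae (Filter.Eventually.of_forall fun x => ?_)
  simp only [magDeriv_landauFun m' k' hB.le j]
  ring

lemma integral_conj_magDeriv_landauFun_mul (hB : 0 < B) (j : Fin 2) :
    ∫ x, conj (magDeriv B j (landauFun B m k) x) * landauFun B m' k' x = (√(B / 2) : ℝ) *
      (conj (ladderPhase j) * (∫ x, conj (landauFun B (m + 1) k x) * landauFun B m' k' x) +
        m * ladderPhase j * ∫ x, conj (landauFun B (m - 1) k x) * landauFun B m' k' x) := by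
  have hconj := congrArg conj (integral_conj_landauFun_mul_magDeriv m' k' m k hB j)
  simpa [← integral_conj, mul_comm] using hconj

lemma integral_conj_landauFun_succ_mul (hB : 0 < B) :
    ∫ x, conj (landauFun B (m + 1) k x) * landauFun B m' k' x =
      m' * ∫ x, conj (landauFun B m k x) * landauFun B (m' - 1) k' x := by
  have hs : ((√(B / 2) : ℝ) : ℂ) ≠ 0 := by
    exact_mod_cast (Real.sqrt_pos.2 (half_pos hB)).ne'
  let J (a b : ℕ) : ℂ := ∫ x, conj (landauFun B a k x) * landauFun B b k' x
  have hJ (j : Fin 2) : conj (ladderPhase j) * J (m + 1) m' + m * ladderPhase j * J (m - 1) m' =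
      ladderPhase j * J m (m' + 1) + m' * conj (ladderPhase j) * J m (m' - 1) := by
    refine mul_left_cancel₀ hs ?_
    rw [← integral_conj_magDeriv_landauFun_mul _ _ _ _ hB,
      ← integral_conj_landauFun_mul_magDeriv _ _ _ _ hB]
    exact integral_conj_magDeriv_symm (contDiff_landauFun B m k) (memLp_landauFun m k hB)
      (memLp_magDeriv_landauFun m k hB j) (contDiff_landauFun B m' k')
      (memLp_landauFun m' k' hB) (memLp_magDeriv_landauFun m' k' hB j)
  have h0 := hJ 0
  have h1 := hJ 1
  simp only [ladderPhase, Matrix.cons_val_zero, Matrix.cons_val_one, Complex.conj_I, map_neg,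
    map_one] at h0 h1
  change J (m + 1) m' = m' * J m (m' - 1)
  -- Weighting with the phases isolates two of the four terms, as `∑ pⱼ² = 0` and `∑ |pⱼ|² = 2`.
  linear_combination (Complex.I * h0 - h1) / 2 +
    (J (m + 1) m' - m * J (m - 1) m' + J m (m' + 1) - m' * J m (m' - 1)) / 2 * Complex.I_sq

lemma integral_conj_landauFun_mul_eq_ite (hB : 0 < B) :
    ∫ x, conj (landauFun B m k x) * landauFun B m' k' x =
      if m = m' then (m.factorial : ℂ) * ∫ x, conj (landauFun B 0 k x) * landauFun B 0 k' x
      else 0 := by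
  induction m generalizing m' with
  | zero =>
    cases m' with
    | zero => simp
    | succ m' =>
      have hzero := congrArg conj (integral_conj_landauFun_succ_mul m' k' 0 k hB)
      simpa [← integral_conj, mul_comm] using hzero
  | succ m ih =>
    rw [integral_conj_landauFun_succ_mul _ _ _ _ hB]
    cases m' with
    | zero => simp
    | succ m' =>
      rw [Nat.add_sub_cancel, ih]
      by_cases h : m = m'
      · subst h
        simp [Nat.factorial_succ, mul_assoc]
      · simp [h]

lemma integral_conj_landauFun_zero_zero_mul_self (hB : 0 < B) :
    ∫ x, conj (landauFun B 0 0 x) * landauFun B 0 0 x = ((2 * Real.pi / B : ℝ) : ℂ) := by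
  have hgauss := GaussianFourier.integral_rexp_neg_mul_sq_norm (V := Plane) (half_pos hB)
  have hsq (x : Plane) : conj (landauFun B 0 0 x) * landauFun B 0 0 x =
      ((Real.exp (-(B / 2) * ‖x‖ ^ 2) : ℝ) : ℂ) := by
    rw [conj_landauFun, landauFun, complexHermite_zero, pow_zero, one_mul, ← Complex.ofReal_mul,
      ← Real.exp_add]
    congr 2
    ring
  simp_rw [hsq]
  rw [integral_complex_ofReal, hgauss, finrank_euclideanSpace_fin]
  congr 1
  norm_num
  field_simp

theorem integral_conj_landauFun_mul (hB : 0 < B) :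
    ∫ x, conj (landauFun B m k x) * landauFun B m' k' x =
      if m = m' ∧ k = k' then ((2 * Real.pi / B * (m.factorial * k.factorial) : ℝ) : ℂ) else 0 := by
  rw [integral_conj_landauFun_mul_eq_ite _ _ _ _ hB, integral_conj_landauFun_mul_swap,
    integral_conj_landauFun_mul_eq_ite _ _ _ _ hB, integral_conj_landauFun_zero_zero_mul_self hB]
  by_cases hm : m = m' <;> by_cases hk : k = k'
  · subst hm hk
    simp only [and_self, if_true]
    push_cast
    ring
  all_goals simp [hm, hk, Ne.symm]

end LandauOrthogonality

/-! ### Completeness of the Landau functions -/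

lemma inner_eq_integral {α : Type*} [MeasurableSpace α] {μ : Measure α} (u v : Lp ℂ 2 μ) :
    inner ℂ u v = ∫ x, conj (u x) * v x ∂μ := by
  simp_rw [L2.inner_def, RCLike.inner_apply, mul_comm]

lemma integral_cexp_mul_eq_zero {α : Type*} [MeasurableSpace α] {μ : Measure α} {L f : α → ℂ}
    (hL : AEStronglyMeasurable L μ) (hf : AEStronglyMeasurable f μ)
    (hint : Integrable (fun x => Real.exp ‖L x‖ * ‖f x‖) μ)
    (h : ∀ n : ℕ, ∫ x, L x ^ n * f x ∂μ = 0) : ∫ x, Complex.exp (L x) * f x ∂μ = 0 := by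
  have hsum (x : α) : HasSum (fun n : ℕ => ‖L x‖ ^ n / n.factorial * ‖f x‖)
      (Real.exp ‖L x‖ * ‖f x‖) := by
    rw [Real.exp_eq_exp_ℝ]
    exact (NormedSpace.expSeries_div_hasSum_exp ‖L x‖).mul_right _
  have hseries := hasSum_integral_of_dominated_convergence (μ := μ)
    (F := fun (n : ℕ) x => L x ^ n / n.factorial * f x) (f := fun x => Complex.exp (L x) * f x)
    (fun n x => ‖L x‖ ^ n / n.factorial * ‖f x‖)
    (fun n => ((hL.aemeasurable.pow_const n).div_const _).aestronglyMeasurable.mul hf)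
    (fun n => Filter.Eventually.of_forall fun x => by simp)
    (Filter.Eventually.of_forall fun x => (hsum x).summable)
    (hint.congr (Filter.Eventually.of_forall fun x => (hsum x).tsum_eq.symm))
    (Filter.Eventually.of_forall fun x => by
      rw [Complex.exp_eq_exp_ℂ]
      exact (NormedSpace.expSeries_div_hasSum_exp (L x)).mul_right _)
  refine hseries.unique ((hasSum_zero).congr_fun fun n => ?_)
  simp_rw [div_mul_eq_mul_div, integral_div, h, zero_div]

section Fourier

open scoped FourierTransform

variable {F : Type*} [NormedAddCommGroup F] [InnerProductSpace ℝ F] [FiniteDimensional ℝ F]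
  [MeasurableSpace F] [BorelSpace F]

lemma ae_eq_zero_of_fourier_eq_zero {f : F → ℂ} (hf : Integrable f volume)
    (h : ∀ ξ, 𝓕 f ξ = 0) : ∀ᵐ x, f x = 0 := by
  refine ae_eq_zero_of_integral_contDiff_smul_eq_zero hf.locallyIntegrable fun g hg hgc => ?_
  have hgℂ : HasCompactSupport (Complex.ofRealCLM ∘ g) := hgc.comp_left rfl
  let S : SchwartzMap F ℂ := hgℂ.toSchwartzMap (by fun_prop)
  have hS (x : F) : 𝓕 (𝓕⁻ S : SchwartzMap F ℂ) x = (g x : ℂ) := by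
    rw [FourierTransform.fourier_fourierInv_eq S]
    rfl
  have hflip := VectorFourier.integral_fourierIntegral_smul_eq_flip (L := innerₗ F)
    Real.continuous_fourierChar continuous_inner (𝓕⁻ S : SchwartzMap F ℂ).integrable hf
    (μ := volume) (ν := volume)
  have hleft (x : F) : VectorFourier.fourierIntegral Real.fourierChar volume (innerₗ F)
      (𝓕⁻ S : SchwartzMap F ℂ) x = (g x : ℂ) := by
    rw [← hS, SchwartzMap.fourier_coe]
    rfl
  have hright (x : F) :
      VectorFourier.fourierIntegral Real.fourierChar volume (innerₗ F).flip f x = 0 := by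
    rw [← h x, flip_innerₗ]
    rfl
  simp_rw [hleft, hright, smul_zero, integral_zero] at hflip
  simpa using hflip

/-- The moments are the Taylor coefficients of the Fourier transform, which is entire. -/
lemma ae_eq_zero_of_moments_eq_zero {f : F → ℂ} (hf : AEStronglyMeasurable f volume)
    (hint : ∀ κ : ℝ, Integrable (fun x => Real.exp (κ * ‖x‖) * ‖f x‖) volume)
    (h : ∀ (ξ : F) (n : ℕ), ∫ x, ((inner ℝ x ξ : ℝ) : ℂ) ^ n * f x = 0) : ∀ᵐ x, f x = 0 := by
  have hf1 : Integrable f volume := by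
    refine (integrable_norm_iff hf).1 ?_
    simpa using hint 0
  refine ae_eq_zero_of_fourier_eq_zero hf1 fun ξ => ?_
  set c : ℂ := -(2 * Real.pi) * Complex.I with hc
  have hL : Continuous fun x : F => c * ((inner ℝ x ξ : ℝ) : ℂ) := by fun_prop
  have hexp : ∫ x, Complex.exp (c * ((inner ℝ x ξ : ℝ) : ℂ)) * f x = 0 := by
    refine integral_cexp_mul_eq_zero hL.aestronglyMeasurable hf ?_ fun n => ?_
    · refine (hint (‖c‖ * ‖ξ‖)).mono' ?_ (Filter.Eventually.of_forall fun x => ?_)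
      · exact (Real.continuous_exp.comp hL.norm).aestronglyMeasurable.mul hf.norm
      · rw [Real.norm_of_nonneg (by positivity), norm_mul c, Complex.norm_real, mul_assoc,
          mul_comm ‖ξ‖]
        gcongr
        exact norm_inner_le_norm x ξ
    · simp_rw [mul_pow, mul_assoc, integral_const_mul, h, mul_zero]
  rw [Real.fourier_eq, ← hexp]
  refine integral_congr_ae (Filter.Eventually.of_forall fun x => ?_)
  simp only [Circle.smul_def, Real.fourierChar_apply, smul_eq_mul, hc]
  congr 2
  push_cast
  ring

end Fourier

section LandauCompleteness

variable {B : ℝ}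

lemma exists_inner_eq_landauCoord (hB : 0 < B) (ξ : Plane) : ∃ s t : ℂ, ∀ x : Plane,
    ((inner ℝ x ξ : ℝ) : ℂ) = s * conj (landauCoord B x) + t * landauCoord B x := by
  have hs : ((√(B / 2) : ℝ) : ℂ) ≠ 0 := by
    exact_mod_cast (Real.sqrt_pos.2 (half_pos hB)).ne'
  refine ⟨(ξ 0 + Complex.I * ξ 1) / (2 * (√(B / 2) : ℝ)),
    (ξ 0 - Complex.I * ξ 1) / (2 * (√(B / 2) : ℝ)), fun x => ?_⟩
  rw [conj_landauCoord, landauCoord_apply, EuclideanSpace.inner_eq_star_dotProduct]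
  generalize ((√(B / 2) : ℝ) : ℂ) = s at hs ⊢
  simp only [star_trivial, dotProduct, Fin.sum_univ_two]
  push_cast
  field_simp
  linear_combination (2 * x 1 * ξ 1) * Complex.I_sq

variable (B)

/-- The span of the Landau functions, that is, polynomials times the Gaussian
`exp (-B |x|² / 4)`. -/
def landauSpan : Submodule ℂ (Plane → ℂ) :=
  Submodule.span ℂ (Set.range fun p : ℕ × ℕ => landauFun B p.1 p.2)

lemma landauFun_mem_landauSpan (m k : ℕ) : landauFun B m k ∈ landauSpan B :=
  Submodule.subset_span ⟨(m, k), rfl⟩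

lemma mul_mem_landauSpan (s t : ℂ) {g : Plane → ℂ} (hg : g ∈ landauSpan B) :
    (fun x => s * conj (landauCoord B x) + t * landauCoord B x) * g ∈ landauSpan B := by
  set L : Plane → ℂ := fun x => s * conj (landauCoord B x) + t * landauCoord B x
  suffices h : landauSpan B ≤ (landauSpan B).comap (LinearMap.mulLeft ℂ L) from h hg
  refine Submodule.span_le.2 ?_
  rintro _ ⟨⟨m, k⟩, rfl⟩
  have hrec : L * landauFun B m k =
      s • (landauFun B (m + 1) k + (k : ℂ) • landauFun B m (k - 1)) +
        t • (landauFun B m (k + 1) + (m : ℂ) • landauFun B (m - 1) k) := by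
    ext x
    simp only [L, Pi.mul_apply, Pi.add_apply, Pi.smul_apply, smul_eq_mul, landauFun]
    linear_combination (Real.exp (-(B / 4) * ‖x‖ ^ 2) : ℂ) *
      (s * conj_mul_complexHermite m k (landauCoord B x) +
        t * mul_complexHermite m k (landauCoord B x))
  rw [SetLike.mem_coe, Submodule.mem_comap, LinearMap.mulLeft_apply, hrec]
  exact add_mem
    (Submodule.smul_mem _ _ (add_mem (landauFun_mem_landauSpan B _ _)
      (Submodule.smul_mem _ _ (landauFun_mem_landauSpan B _ _))))
    (Submodule.smul_mem _ _ (add_mem (landauFun_mem_landauSpan B _ _)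
      (Submodule.smul_mem _ _ (landauFun_mem_landauSpan B _ _))))

lemma pow_mul_landauFun_mem_landauSpan (s t : ℂ) (n m k : ℕ) :
    (fun x => s * conj (landauCoord B x) + t * landauCoord B x) ^ n * landauFun B m k ∈
      landauSpan B := by
  induction n with
  | zero => simpa using landauFun_mem_landauSpan B m k
  | succ n ih =>
    rw [pow_succ', mul_assoc]
    exact mul_mem_landauSpan B s t ih

variable {B} {f g : Plane → ℂ}

lemma integral_mul_eq_zero_of_mem_landauSpan (hB : 0 < B) (hf : MemLp f 2 volume)
    (h : ∀ m k, ∫ x, landauFun B m k x * f x = 0) (hg : g ∈ landauSpan B) :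
    ∫ x, g x * f x = 0 := by
  suffices hmem : MemLp g 2 volume ∧ ∫ x, g x * f x = 0 from hmem.2
  induction hg using Submodule.span_induction with
  | mem g hg =>
    obtain ⟨⟨m, k⟩, rfl⟩ := hg
    exact ⟨memLp_landauFun m k hB, h m k⟩
  | zero => exact ⟨MemLp.zero, by simp⟩
  | add g₁ g₂ _ _ h₁ h₂ =>
    refine ⟨h₁.1.add h₂.1, ?_⟩
    simp_rw [Pi.add_apply, add_mul]
    refine (integral_add (h₁.1.integrable_mul hf) (h₂.1.integrable_mul hf)).trans ?_
    simp only [Pi.mul_apply, h₁.2, h₂.2, add_zero]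
  | smul c g _ hg =>
    refine ⟨hg.1.const_mul c, ?_⟩
    simp_rw [Pi.smul_apply, smul_eq_mul, mul_assoc, integral_const_mul, hg.2, mul_zero]

lemma norm_landauFun_zero_zero (B : ℝ) (x : Plane) :
    ‖landauFun B 0 0 x‖ = Real.exp (-(B / 4) * ‖x‖ ^ 2) := by
  rw [landauFun, complexHermite_zero, pow_zero, one_mul, Complex.norm_real,
    Real.norm_of_nonneg (Real.exp_pos _).le]

theorem ae_eq_zero_of_integral_landauFun_mul_eq_zero (hB : 0 < B) (hf : MemLp f 2 volume)
    (h : ∀ m k, ∫ x, landauFun B m k x * f x = 0) : ∀ᵐ x, f x = 0 := by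
  have hint (κ : ℝ) :
      Integrable (fun x => Real.exp (κ * ‖x‖) * ‖landauFun B 0 0 x * f x‖) volume := by
    have hexp : MemLp (fun x : Plane => Real.exp (κ * ‖x‖ - B / 4 * ‖x‖ ^ 2)) 2 volume := by
      refine memLp_two_of_norm_le_exp (a := B / 4) (C := 1) (κ := κ) (by positivity)
        (Continuous.aestronglyMeasurable (by fun_prop)) fun x => ?_
      rw [Real.norm_of_nonneg (Real.exp_pos _).le, one_mul]
    refine (hexp.integrable_mul hf.norm).congr (Filter.Eventually.of_forall fun x => ?_)
    simp only [Pi.mul_apply, norm_mul, norm_landauFun_zero_zero]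
    rw [← mul_assoc, ← Real.exp_add, neg_mul, ← sub_eq_add_neg]
  have hmoment (ξ : Plane) (n : ℕ) :
      ∫ x, ((inner ℝ x ξ : ℝ) : ℂ) ^ n * (landauFun B 0 0 x * f x) = 0 := by
    obtain ⟨s, t, hst⟩ := exists_inner_eq_landauCoord hB ξ
    simp_rw [← mul_assoc, hst]
    exact integral_mul_eq_zero_of_mem_landauSpan hB hf h
      (pow_mul_landauFun_mem_landauSpan B s t n 0 0)
  filter_upwards [ae_eq_zero_of_moments_eq_zero
    ((continuous_landauFun B 0 0).aestronglyMeasurable.mul hf.1) hint hmoment] with x hx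
  refine (mul_eq_zero.1 hx).resolve_left (norm_ne_zero_iff.1 ?_)
  rw [norm_landauFun_zero_zero]
  exact (Real.exp_pos _).ne'

end LandauCompleteness

/-! ### The Landau basis -/

section HilbertSpace

variable {𝕜 H ι : Type*} [RCLike 𝕜] [NormedAddCommGroup H] [InnerProductSpace 𝕜 H]

lemma norm_sum_smul_sq_of_orthonormal {e : ι → H} (he : Orthonormal 𝕜 e) (s : Finset ι)
    (a : ι → 𝕜) : ‖∑ i ∈ s, a i • e i‖ ^ 2 = ∑ i ∈ s, ‖a i‖ ^ 2 := by
  rw [← inner_self_eq_norm_sq (𝕜 := 𝕜), he.inner_sum, map_sum]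
  simp only [RCLike.conj_mul, ← RCLike.ofReal_pow, RCLike.ofReal_re]

lemma norm_sub_sum_inner_smul_sq_of_orthonormal {e : ι → H} (he : Orthonormal 𝕜 e) (s : Finset ι)
    (u : H) : ‖u - ∑ i ∈ s, inner 𝕜 (e i) u • e i‖ ^ 2 =
      ‖u‖ ^ 2 - ∑ i ∈ s, ‖inner 𝕜 (e i) u‖ ^ 2 := by
  have hcross : RCLike.re (inner 𝕜 u (∑ i ∈ s, inner 𝕜 (e i) u • e i)) =
      ∑ i ∈ s, ‖inner 𝕜 (e i) u‖ ^ 2 := by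
    simp only [inner_sum, inner_smul_right, map_sum, ← inner_conj_symm u (e _), RCLike.mul_conj,
      ← RCLike.ofReal_pow, RCLike.ofReal_re]
  rw [norm_sub_sq (𝕜 := 𝕜), hcross, norm_sum_smul_sq_of_orthonormal he]
  ring

lemma hasSum_norm_inner_sq (b : HilbertBasis ι 𝕜 H) (u : H) :
    HasSum (fun i => ‖inner 𝕜 (b i) u‖ ^ 2) (‖u‖ ^ 2) := by
  simpa [b.repr_apply_apply] using lp.hasSum_norm (p := 2) (by norm_num) (b.repr u)

end HilbertSpace

/-- The constant normalizing `landauFun B m k` in `L²(ℝ²)`. -/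
noncomputable def landauConst (B : ℝ) (m k : ℕ) : ℝ :=
  √(B / (2 * Real.pi) / (m.factorial * k.factorial))

section LandauBasis

variable {B : ℝ}

lemma landauConst_pos (hB : 0 < B) (m k : ℕ) : 0 < landauConst B m k :=
  Real.sqrt_pos.2 (by positivity)

lemma landauConst_sq (hB : 0 ≤ B) (m k : ℕ) :
    landauConst B m k ^ 2 = B / (2 * Real.pi) / (m.factorial * k.factorial) :=
  Real.sq_sqrt (by positivity)

lemma landauConst_eq_succ (m k : ℕ) :
    landauConst B m k = √((m : ℝ) + 1) * landauConst B (m + 1) k := by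
  rw [landauConst, landauConst, ← Real.sqrt_mul (by positivity), Nat.factorial_succ]
  push_cast
  field_simp

lemma landauConst_mul_eq_pred (m k : ℕ) :
    landauConst B m k * m = √(m : ℝ) * landauConst B (m - 1) k := by
  cases m with
  | zero => simp
  | succ m =>
    rw [Nat.add_sub_cancel, landauConst_eq_succ m k, ← mul_assoc]
    push_cast
    rw [Real.mul_self_sqrt (by positivity), mul_comm]

/-- The normalized Landau functions, as elements of `L²(ℝ²)`: `landauVec hB (m, k)` is the `k`-th
vector of the `m`-th Landau level. -/
noncomputable def landauVec (hB : 0 < B) (p : ℕ × ℕ) : L2Plane :=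
  (landauConst B p.1 p.2 : ℂ) • (memLp_landauFun p.1 p.2 hB).toLp

lemma coeFn_landauVec (hB : 0 < B) (p : ℕ × ℕ) :
    landauVec hB p =ᵐ[volume] fun x => (landauConst B p.1 p.2 : ℂ) * landauFun B p.1 p.2 x := by
  filter_upwards [Lp.coeFn_smul (landauConst B p.1 p.2 : ℂ) (memLp_landauFun p.1 p.2 hB).toLp,
    (memLp_landauFun p.1 p.2 hB).coeFn_toLp] with x hsmul htoLp
  rw [landauVec, hsmul, Pi.smul_apply, htoLp, smul_eq_mul]

lemma inner_landauVec (hB : 0 < B) (p : ℕ × ℕ) (u : L2Plane) :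
    inner ℂ (landauVec hB p) u =
      landauConst B p.1 p.2 * ∫ x, conj (landauFun B p.1 p.2 x) * u x := by
  rw [inner_eq_integral, ← integral_const_mul]
  refine integral_congr_ae ?_
  filter_upwards [coeFn_landauVec hB p] with x hx
  rw [hx, map_mul, Complex.conj_ofReal, mul_assoc]

lemma orthonormal_landauVec (hB : 0 < B) : Orthonormal ℂ (landauVec hB) := by
  rw [orthonormal_iff_ite]
  rintro ⟨m, k⟩ ⟨m', k'⟩
  have hright : ∫ x, conj (landauFun B m k x) * landauVec hB (m', k') x =
      landauConst B m' k' * ∫ x, conj (landauFun B m k x) * landauFun B m' k' x := by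
    rw [← integral_const_mul]
    refine integral_congr_ae ?_
    filter_upwards [coeFn_landauVec hB (m', k')] with x hx
    rw [hx, mul_left_comm]
  rw [inner_landauVec, hright, integral_conj_landauFun_mul m k m' k' hB]
  simp only [Prod.mk.injEq]
  split_ifs with h
  · obtain ⟨rfl, rfl⟩ := h
    have hnorm : landauConst B m k ^ 2 * (2 * Real.pi / B * (m.factorial * k.factorial)) = 1 := by
      rw [landauConst_sq hB.le]
      field_simp
    exact_mod_cast (mul_assoc _ _ _).symm.trans ((sq (landauConst B m k)) ▸ hnorm)
  · rw [mul_zero, mul_zero]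

lemma span_landauVec_orthogonal (hB : 0 < B) :
    (Submodule.span ℂ (Set.range (landauVec hB)))ᗮ = ⊥ := by
  refine (Submodule.eq_bot_iff _).2 fun f hf => (Lp.eq_zero_iff_ae_eq_zero).2 ?_
  refine ae_eq_zero_of_integral_landauFun_mul_eq_zero hB (Lp.memLp f) fun m k => ?_
  have hinner : inner ℂ (landauVec hB (k, m)) f = 0 := hf _ (Submodule.subset_span ⟨(k, m), rfl⟩)
  rw [inner_landauVec] at hinner
  simpa [conj_landauFun, (landauConst_pos hB k m).ne'] using hinner

/-- The basis of `L²(ℝ²)` made of the normalized Landau functions. -/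
noncomputable def landauBasis (hB : 0 < B) : HilbertBasis (ℕ × ℕ) ℂ L2Plane :=
  HilbertBasis.mkOfOrthogonalEqBot (orthonormal_landauVec hB) (span_landauVec_orthogonal hB)

lemma landauBasis_apply (hB : 0 < B) (p : ℕ × ℕ) : landauBasis hB p = landauVec hB p := by
  rw [landauBasis, HilbertBasis.coe_mkOfOrthogonalEqBot]

lemma norm_landauConst_mul_landauFun_sq (hB : 0 ≤ B) (m k : ℕ) (x : Plane) :
    ‖(landauConst B m k : ℂ) * landauFun B m k x‖ ^ 2 =
      B / (2 * Real.pi) * Real.exp (-(B / 2 * ‖x‖ ^ 2)) / m.factorial *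
        (‖complexHermite m k (landauCoord B x)‖ ^ 2 / k.factorial) := by
  have hexp : Real.exp (-(B / 4) * ‖x‖ ^ 2) ^ 2 = Real.exp (-(B / 2 * ‖x‖ ^ 2)) := by
    rw [← Real.exp_nat_mul]
    congr 1
    push_cast
    ring
  simp only [landauFun, norm_mul, mul_pow, Complex.norm_real, Real.norm_eq_abs, sq_abs,
    landauConst_sq hB, hexp]
  field_simp

lemma sum_norm_landauConst_mul_landauFun_sq_le (hB : 0 ≤ B) (m K : ℕ) (x : Plane) :
    ∑ k ∈ Finset.range K, ‖(landauConst B m k : ℂ) * landauFun B m k x‖ ^ 2 ≤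
      B / (2 * Real.pi) := by
  have hsum := (hasSum_norm_complexHermite m (landauCoord B x)).mul_left
    (B / (2 * Real.pi) * Real.exp (-(B / 2 * ‖x‖ ^ 2)) / m.factorial)
  simp_rw [← norm_landauConst_mul_landauFun_sq hB] at hsum
  refine (sum_le_hasSum _ (fun k _ => by positivity) hsum).trans_eq ?_
  rw [norm_landauCoord, mul_pow, Real.sq_sqrt (by positivity), Real.exp_neg]
  field_simp

end LandauBasis

/-! ### Energy and Landau levels -/

section LandauLevels

variable {B : ℝ} {u : L2Plane}

lemma inner_landauBasis (hB : 0 < B) (m k : ℕ) (u : L2Plane) :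
    inner ℂ (landauBasis hB (m, k)) u =
      landauConst B m k * ∫ x, conj (landauFun B m k x) * u x := by
  rw [landauBasis_apply, inner_landauVec]

lemma landauConst_mul_integral_succ (hB : 0 < B) (m k : ℕ) (u : L2Plane) :
    landauConst B m k * ∫ x, conj (landauFun B (m + 1) k x) * u x =
      √((m : ℝ) + 1) * inner ℂ (landauBasis hB (m + 1, k)) u := by
  rw [inner_landauBasis, landauConst_eq_succ, Complex.ofReal_mul, mul_assoc]

lemma landauConst_mul_integral_pred (hB : 0 < B) (m k : ℕ) (u : L2Plane) :
    landauConst B m k * (m * ∫ x, conj (landauFun B (m - 1) k x) * u x) =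
      √(m : ℝ) * inner ℂ (landauBasis hB (m - 1, k)) u := by
  rw [inner_landauBasis, ← mul_assoc, ← mul_assoc, ← Complex.ofReal_natCast,
    ← Complex.ofReal_mul, landauConst_mul_eq_pred, Complex.ofReal_mul]

/-- The magnetic derivatives are combinations of the ladder operators of the Landau levels. -/
lemma inner_landauBasis_weakMagDeriv (hB : 0 < B) {j : Fin 2} {g : L2Plane}
    (h : IsWeakMagDeriv B j u g) (m k : ℕ) :
    inner ℂ (landauBasis hB (m, k)) g = √(B / 2) *
      (conj (ladderPhase j) * (√((m : ℝ) + 1) * inner ℂ (landauBasis hB (m + 1, k)) u) +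
        ladderPhase j * (√(m : ℝ) * inner ℂ (landauBasis hB (m - 1, k)) u)) := by
  have hint (n : ℕ) : Integrable (fun x => conj (landauFun B n k x) * u x) volume :=
    integrable_conj_mul (memLp_landauFun n k hB) (Lp.memLp u)
  have hderiv : ∫ x, conj (magDeriv B j (landauFun B m k) x) * u x = √(B / 2) *
      (conj (ladderPhase j) * (∫ x, conj (landauFun B (m + 1) k x) * u x) +
        ladderPhase j * (m * ∫ x, conj (landauFun B (m - 1) k x) * u x)) := by
    simp_rw [← integral_const_mul]
    rw [← integral_add ((hint _).const_mul _) (((hint _).const_mul _).const_mul _),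
      ← integral_const_mul]
    refine integral_congr_ae (Filter.Eventually.of_forall fun x => ?_)
    simp only [magDeriv_landauFun m k hB.le, map_mul, map_add, Complex.conj_ofReal,
      Complex.conj_conj, map_natCast]
    ring
  rw [inner_landauBasis, ← integral_conj_magDeriv_of_memLp (Lp.memLp u) (Lp.memLp g) h
    (contDiff_landauFun B m k) (memLp_landauFun m k hB) (memLp_magDeriv_landauFun m k hB j),
    hderiv, ← landauConst_mul_integral_succ, ← landauConst_mul_integral_pred]
  ring

lemma norm_conj_ladderPhase_mul_add_sq (a b : ℂ) :
    ∑ j, ‖conj (ladderPhase j) * a + ladderPhase j * b‖ ^ 2 = 2 * (‖a‖ ^ 2 + ‖b‖ ^ 2) := by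
  have hsub : ‖-Complex.I * a + Complex.I * b‖ = ‖a - b‖ := by
    rw [show -Complex.I * a + Complex.I * b = -(Complex.I * (a - b)) by ring, norm_neg, norm_mul,
      Complex.norm_I, one_mul]
  have hadd : ‖-1 * a + -1 * b‖ = ‖a + b‖ := by
    rw [← norm_neg (a + b)]
    ring_nf
  have hparallelogram := parallelogram_law_with_norm ℝ a b
  simp only [Fin.sum_univ_two, ladderPhase, Matrix.cons_val_zero, Matrix.cons_val_one,
    Complex.conj_I, map_neg, map_one, hsub, hadd]
  linarith

lemma sum_norm_inner_landauBasis_weakMagDeriv_sq (hB : 0 < B) {g : Fin 2 → L2Plane}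
    (h : ∀ j, IsWeakMagDeriv B j u (g j)) (m k : ℕ) :
    ∑ j, ‖inner ℂ (landauBasis hB (m, k)) (g j)‖ ^ 2 =
      B * ((m + 1) * ‖inner ℂ (landauBasis hB (m + 1, k)) u‖ ^ 2 +
        m * ‖inner ℂ (landauBasis hB (m - 1, k)) u‖ ^ 2) := by
  have hsqrt (r : ℝ) (hr : 0 ≤ r) (z : ℂ) : ‖(√r : ℂ) * z‖ ^ 2 = r * ‖z‖ ^ 2 := by
    rw [norm_mul, mul_pow, Complex.norm_real, Real.norm_eq_abs, sq_abs, Real.sq_sqrt hr]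
  simp_rw [fun j => inner_landauBasis_weakMagDeriv hB (h j) m k, hsqrt (B / 2) (by positivity),
    ← Finset.mul_sum, norm_conj_ladderPhase_mul_add_sq]
  rw [hsqrt _ (by positivity), hsqrt _ (by positivity)]
  ring

/-- The squared norm of the component of `u` in the `m`-th Landau level. -/
noncomputable def landauWeight (hB : 0 < B) (m : ℕ) (u : L2Plane) : ℝ :=
  ∑' k, ‖inner ℂ (landauBasis hB (m, k)) u‖ ^ 2

lemma landauWeight_nonneg (hB : 0 < B) (m : ℕ) (u : L2Plane) : 0 ≤ landauWeight hB m u :=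
  tsum_nonneg fun _ => by positivity

lemma hasSum_landauWeight_level (hB : 0 < B) (m : ℕ) (u : L2Plane) :
    HasSum (fun k => ‖inner ℂ (landauBasis hB (m, k)) u‖ ^ 2) (landauWeight hB m u) :=
  ((hasSum_norm_inner_sq (landauBasis hB) u).summable.prod_factor m).hasSum

lemma hasSum_landauWeight (hB : 0 < B) (u : L2Plane) :
    HasSum (fun m => landauWeight hB m u) (‖u‖ ^ 2) :=
  (hasSum_norm_inner_sq (landauBasis hB) u).prod_fiberwise (hasSum_landauWeight_level hB · u)

lemma sum_landauWeight_weakMagDeriv (hB : 0 < B) {g : Fin 2 → L2Plane}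
    (h : ∀ j, IsWeakMagDeriv B j u (g j)) (m : ℕ) :
    ∑ j, landauWeight hB m (g j) =
      B * ((m + 1) * landauWeight hB (m + 1) u + m * landauWeight hB (m - 1) u) := by
  have hleft := hasSum_sum fun j (_ : j ∈ Finset.univ) => hasSum_landauWeight_level hB m (g j)
  simp_rw [sum_norm_inner_landauBasis_weakMagDeriv_sq hB h] at hleft
  exact hleft.unique ((((hasSum_landauWeight_level hB (m + 1) u).mul_left _).add
    ((hasSum_landauWeight_level hB (m - 1) u).mul_left _)).mul_left B)

end LandauLevels

lemma sum_ladder_eq (a : ℕ → ℝ) (M : ℕ) :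
    ∑ m ∈ Finset.range (M + 1), ((m + 1) * a (m + 1) + m * a (m - 1)) =
      ∑ m ∈ Finset.range M, (2 * m + 1) * a m + (M * a M + (M + 1) * a (M + 1)) := by
  induction M with
  | zero => simp
  | succ M ih =>
    rw [Finset.sum_range_succ, ih, Finset.sum_range_succ, Nat.add_sub_cancel]
    push_cast
    ring

/-- The factor `2 m + 1` counts the level `m` once, and twice for each `n < m`. -/
lemma sum_odd_mul_eq (a : ℕ → ℝ) (M : ℕ) :
    ∑ m ∈ Finset.range M, (2 * m + 1) * a m = ∑ m ∈ Finset.range M, a m +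
      2 * ∑ n ∈ Finset.range M,
        (∑ m ∈ Finset.range M, a m - ∑ m ∈ Finset.range (n + 1), a m) := by
  induction M with
  | zero => simp
  | succ M ih =>
    rw [Finset.sum_range_succ, ih, Finset.sum_range_succ _ M, Finset.sum_range_succ _ M]
    simp only [Finset.sum_sub_distrib, Finset.sum_const, Finset.card_range, nsmul_eq_mul]
    rw [Finset.sum_range_succ _ M]
    ring

section EnergyBound

variable {B : ℝ} {u : L2Plane} {g : Fin 2 → L2Plane}

lemma sum_landauWeight_le_energy (hB : 0 < B) (h : ∀ j, IsWeakMagDeriv B j u (g j)) (M : ℕ) :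
    B * ∑ m ∈ Finset.range M, (2 * m + 1) * landauWeight hB m u ≤ ∑ j, ‖g j‖ ^ 2 :=
  calc B * ∑ m ∈ Finset.range M, (2 * m + 1) * landauWeight hB m u
    _ ≤ B * ∑ m ∈ Finset.range (M + 1),
          ((m + 1) * landauWeight hB (m + 1) u + m * landauWeight hB (m - 1) u) := by
        rw [sum_ladder_eq fun m => landauWeight hB m u]
        have hM := landauWeight_nonneg hB M u
        have hM' := landauWeight_nonneg hB (M + 1) u
        exact mul_le_mul_of_nonneg_left (le_add_of_nonneg_right (by positivity)) hB.le
    _ = ∑ j, ∑ m ∈ Finset.range (M + 1), landauWeight hB m (g j) := by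
        rw [Finset.sum_comm, Finset.mul_sum]
        exact Finset.sum_congr rfl fun m _ => (sum_landauWeight_weakMagDeriv hB h m).symm
    _ ≤ ∑ j, ‖g j‖ ^ 2 := Finset.sum_le_sum fun j _ =>
        sum_le_hasSum _ (fun m _ => landauWeight_nonneg hB m _) (hasSum_landauWeight hB (g j))

lemma norm_sq_add_sum_le_energy (hB : 0 < B) (h : ∀ j, IsWeakMagDeriv B j u (g j)) (N : ℕ) :
    B * (‖u‖ ^ 2 + 2 * ∑ n ∈ Finset.range N,
      (‖u‖ ^ 2 - ∑ m ∈ Finset.range (n + 1), landauWeight hB m u)) ≤ ∑ j, ‖g j‖ ^ 2 := by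
  have hpartial : Filter.Tendsto (fun M => ∑ m ∈ Finset.range M, landauWeight hB m u)
      Filter.atTop (nhds (‖u‖ ^ 2)) := (hasSum_landauWeight hB u).tendsto_sum_nat
  refine le_of_tendsto ((hpartial.add ((tendsto_finsetSum _ fun n _ =>
    hpartial.sub_const _).const_mul 2)).const_mul B) ?_
  filter_upwards [Filter.eventually_ge_atTop N] with M hM
  refine le_trans ?_ (sum_landauWeight_le_energy hB h M)
  rw [sum_odd_mul_eq]
  gcongr B * (_ + 2 * ?_)
  refine Finset.sum_le_sum_of_subset_of_nonneg (Finset.range_mono hM) fun n hn _ => ?_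
  exact sub_nonneg.2 (Finset.sum_le_sum_of_subset_of_nonneg
    (Finset.range_mono (Finset.mem_range.1 hn)) fun m _ _ => landauWeight_nonneg hB m u)

end EnergyBound

/-! ### The kinetic energy inequality -/

/-- A finite family `ψ` is a Bessel family (with bound one) if `∑ |ψ i⟩⟨ψ i| ≤ 1`. -/
def IsBesselFamily (𝕜 : Type*) {ι H : Type*} [RCLike 𝕜] [Fintype ι] [NormedAddCommGroup H]
    [InnerProductSpace 𝕜 H] (ψ : ι → H) : Prop :=
  ∀ f : H, ∑ i, ‖inner 𝕜 (ψ i) f‖ ^ 2 ≤ ‖f‖ ^ 2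

lemma IsBesselFamily.sum_norm_sum_inner_mul_sq_le {𝕜 ι κ H : Type*} [RCLike 𝕜] [Fintype ι]
    [NormedAddCommGroup H] [InnerProductSpace 𝕜 H] {ψ : ι → H} (hψ : IsBesselFamily 𝕜 ψ)
    {e : κ → H} (he : Orthonormal 𝕜 e) (s : Finset κ) (a : κ → 𝕜) :
    ∑ i, ‖∑ p ∈ s, inner 𝕜 (e p) (ψ i) * a p‖ ^ 2 ≤ ∑ p ∈ s, ‖a p‖ ^ 2 := by
  set f : H := ∑ p ∈ s, conj (a p) • e p
  have hf (i : ι) : ‖∑ p ∈ s, inner 𝕜 (e p) (ψ i) * a p‖ = ‖inner 𝕜 (ψ i) f‖ := by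
    simp only [f, norm_inner_symm (ψ i), sum_inner, inner_smul_left, RCLike.conj_conj, mul_comm]
  simp_rw [hf]
  refine (hψ f).trans_eq ?_
  simp only [f, norm_sum_smul_sq_of_orthonormal he, RCLike.norm_conj]

lemma continuous_densityGap (a : ℝ) : Continuous (densityGap a) := by
  unfold densityGap; fun_prop

lemma densityGap_le_self (a : ℝ) {ρ : ℝ} (hρ : 0 ≤ ρ) : densityGap a ρ ≤ ρ := by
  conv_rhs => rw [← Real.sq_sqrt hρ]
  unfold densityGap
  gcongr
  exact max_le (sub_le_self _ (Real.sqrt_nonneg a)) (Real.sqrt_nonneg ρ)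

lemma densityGap_sum_le {ι : Type*} [Fintype ι] {r : ℝ} (a b : ι → ℂ) (hb : ∑ i, ‖b i‖ ^ 2 ≤ r) :
    densityGap r (∑ i, ‖a i‖ ^ 2) ≤ ∑ i, ‖a i - b i‖ ^ 2 := by
  have htriangle : √(∑ i, ‖a i‖ ^ 2) ≤ √(∑ i, ‖a i - b i‖ ^ 2) + √(∑ i, ‖b i‖ ^ 2) := by
    simpa [EuclideanSpace.norm_eq] using
      norm_add_le (WithLp.toLp 2 (a - b) : EuclideanSpace ℂ ι) (WithLp.toLp 2 b)
  have hsqrt : √(∑ i, ‖b i‖ ^ 2) ≤ √r := Real.sqrt_le_sqrt hb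
  rw [densityGap, ← Real.sq_sqrt (by positivity : 0 ≤ ∑ i, ‖a i - b i‖ ^ 2)]
  gcongr
  exact max_le (by linarith) (Real.sqrt_nonneg _)

section Density

variable {α ι : Type*} [MeasurableSpace α] {μ : Measure α} [Fintype ι]

/-- The density of the operator `∑ |ψ i⟩⟨ψ i|`. -/
noncomputable def density (ψ : ι → Lp ℂ 2 μ) (x : α) : ℝ :=
  ∑ i, ‖ψ i x‖ ^ 2

lemma density_nonneg (ψ : ι → Lp ℂ 2 μ) (x : α) : 0 ≤ density ψ x :=
  Finset.sum_nonneg fun _ _ => by positivity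

lemma integrable_norm_sq (u : Lp ℂ 2 μ) : Integrable (fun x => ‖u x‖ ^ 2) μ :=
  (memLp_two_iff_integrable_sq_norm (Lp.aestronglyMeasurable u)).1 (Lp.memLp u)

lemma norm_sq_eq_integral (u : Lp ℂ 2 μ) : ‖u‖ ^ 2 = ∫ x, ‖u x‖ ^ 2 ∂μ := by
  rw [← inner_self_eq_norm_sq (𝕜 := ℂ), inner_eq_integral]
  simp_rw [RCLike.conj_mul, ← RCLike.ofReal_pow]
  rw [integral_ofReal, RCLike.ofReal_re]

lemma integrable_density (ψ : ι → Lp ℂ 2 μ) : Integrable (density ψ) μ :=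
  integrable_finsetSum _ fun i _ => integrable_norm_sq (ψ i)

lemma integral_density (ψ : ι → Lp ℂ 2 μ) : ∫ x, density ψ x ∂μ = ∑ i, ‖ψ i‖ ^ 2 := by
  simp_rw [norm_sq_eq_integral]
  exact integral_finsetSum _ fun i _ => integrable_norm_sq (ψ i)

lemma integrable_densityGap (a : ℝ) (ψ : ι → Lp ℂ 2 μ) :
    Integrable (fun x => densityGap a (density ψ x)) μ := by
  refine (integrable_density ψ).mono'
    ((continuous_densityGap a).comp_aestronglyMeasurable (integrable_density ψ).1)
    (Filter.Eventually.of_forall fun x => ?_)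
  rw [Real.norm_of_nonneg (densityGap_nonneg _ _)]
  exact densityGap_le_self a (density_nonneg ψ x)

lemma integral_densityGap_le {a : ℝ} (ψ φ : ι → Lp ℂ 2 μ) (hφ : ∀ᵐ x ∂μ, density φ x ≤ a) :
    ∫ x, densityGap a (density ψ x) ∂μ ≤ ∑ i, ‖ψ i - φ i‖ ^ 2 := by
  rw [← integral_density fun i => ψ i - φ i]
  refine integral_mono_ae (integrable_densityGap a ψ) (integrable_density _) ?_
  filter_upwards [hφ, ae_all_iff.2 fun i => Lp.coeFn_sub (ψ i) (φ i)] with x hx hsub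
  simp only [density, hsub, Pi.sub_apply]
  exact densityGap_sum_le _ _ hx

end Density

section KineticEnergy

variable {B : ℝ}

/-- The orthogonal projection of `u` onto the span of the first `K` states of each of the first
`n` Landau levels. -/
noncomputable def landauProj (hB : 0 < B) (n K : ℕ) (u : L2Plane) : L2Plane :=
  ∑ p ∈ Finset.range n ×ˢ Finset.range K, inner ℂ (landauBasis hB p) u • landauBasis hB p

lemma tendsto_norm_sub_landauProj_sq (hB : 0 < B) (n : ℕ) (u : L2Plane) :
    Filter.Tendsto (fun K => ‖u - landauProj hB n K u‖ ^ 2) Filter.atTop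
      (nhds (‖u‖ ^ 2 - ∑ m ∈ Finset.range n, landauWeight hB m u)) := by
  simp_rw [landauProj, norm_sub_sum_inner_smul_sq_of_orthonormal (landauBasis hB).orthonormal,
    Finset.sum_product]
  exact (tendsto_finsetSum _ fun m _ =>
    (hasSum_landauWeight_level hB m u).tendsto_sum_nat).const_sub _

lemma coeFn_landauProj (hB : 0 < B) (n K : ℕ) (u : L2Plane) :
    landauProj hB n K u =ᵐ[volume] fun x => ∑ p ∈ Finset.range n ×ˢ Finset.range K,
      inner ℂ (landauBasis hB p) u * (landauConst B p.1 p.2 * landauFun B p.1 p.2 x) := by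
  filter_upwards [Lp.coeFn_finsetSum (p := 2) (μ := (volume : Measure Plane))
      (Finset.range n ×ˢ Finset.range K)
      fun p => inner ℂ (landauBasis hB p) u • landauBasis hB p,
    ae_all_iff.2 fun p => Lp.coeFn_smul (inner ℂ (landauBasis hB p) u) (landauBasis hB p),
    ae_all_iff.2 fun p => coeFn_landauVec hB p] with x hsum hsmul hvec
  rw [landauProj, hsum, Finset.sum_apply]
  refine Finset.sum_congr rfl fun p _ => ?_
  rw [hsmul, Pi.smul_apply, landauBasis_apply, hvec, smul_eq_mul]

variable {ι : Type*} [Fintype ι] {ψ : ι → L2Plane}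

lemma density_landauProj_le (hB : 0 < B) (hψ : IsBesselFamily ℂ ψ) (n K : ℕ) :
    ∀ᵐ x, density (fun i => landauProj hB n K (ψ i)) x ≤ n * (B / (2 * Real.pi)) := by
  filter_upwards [ae_all_iff.2 fun i => coeFn_landauProj hB n K (ψ i)] with x hx
  simp_rw [density, hx]
  refine (hψ.sum_norm_sum_inner_mul_sq_le (landauBasis hB).orthonormal _ _).trans ?_
  rw [Finset.sum_product]
  refine (Finset.sum_le_card_nsmul _ _ _ fun m _ =>
    sum_norm_landauConst_mul_landauFun_sq_le hB.le m K x).trans_eq ?_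
  rw [Finset.card_range, nsmul_eq_mul]

theorem kinetic_energy_le (hB : 0 < B) (hψ : IsBesselFamily ℂ ψ) {g : ι → Fin 2 → L2Plane}
    (h : ∀ i j, IsWeakMagDeriv B j (ψ i) (g i j)) (N : ℕ) :
    B * ((∫ x, density ψ x) + 2 * ∑ n ∈ Finset.range N,
      ∫ x, densityGap ((n + 1 : ℕ) * (B / (2 * Real.pi))) (density ψ x)) ≤
      ∑ i, ∑ j, ‖g i j‖ ^ 2 := by
  have hgap (n : ℕ) : ∫ x, densityGap (n * (B / (2 * Real.pi))) (density ψ x) ≤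
      ∑ i, (‖ψ i‖ ^ 2 - ∑ m ∈ Finset.range n, landauWeight hB m (ψ i)) :=
    ge_of_tendsto' (tendsto_finsetSum _ fun i _ => tendsto_norm_sub_landauProj_sq hB n (ψ i))
      fun K => integral_densityGap_le ψ _ (density_landauProj_le hB hψ n K)
  calc B * ((∫ x, density ψ x) + 2 * ∑ n ∈ Finset.range N,
        ∫ x, densityGap ((n + 1 : ℕ) * (B / (2 * Real.pi))) (density ψ x))
    _ ≤ B * (∑ i, ‖ψ i‖ ^ 2 + 2 * ∑ n ∈ Finset.range N, ∑ i,
          (‖ψ i‖ ^ 2 - ∑ m ∈ Finset.range (n + 1), landauWeight hB m (ψ i))) := by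
        rw [integral_density]
        gcongr with n
        exact hgap (n + 1)
    _ = ∑ i, B * (‖ψ i‖ ^ 2 + 2 * ∑ n ∈ Finset.range N,
          (‖ψ i‖ ^ 2 - ∑ m ∈ Finset.range (n + 1), landauWeight hB m (ψ i))) := by
        rw [Finset.sum_comm, ← Finset.mul_sum, Finset.sum_add_distrib, ← Finset.mul_sum]
    _ ≤ ∑ i, ∑ j, ‖g i j‖ ^ 2 :=
        Finset.sum_le_sum fun i _ => norm_sq_add_sum_le_energy hB (h i) N

end KineticEnergy

/-! ### The Lieb–Thirring inequality for Bessel families -/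

/-- The sum `∑ ((2 m + 1) B + t)₋` over the Landau levels. -/
noncomputable def levelSum (B t : ℝ) : ℝ≥0∞ :=
  ∑' m : ℕ, ENNReal.ofReal (max (-((2 * (m : ℝ) + 1) * B + t)) 0)

lemma measurable_levelSum (B : ℝ) : Measurable (levelSum B) :=
  Measurable.tsum fun m => by fun_prop

lemma lintegral_levelSum {α : Type*} [MeasurableSpace α] {μ : Measure α} (B : ℝ) {V : α → ℝ}
    (hV : AEMeasurable V μ) : ∫⁻ x, levelSum B (V x) ∂μ =
      ∑' m : ℕ, ∫⁻ x, ENNReal.ofReal (max (-((2 * (m : ℝ) + 1) * B + V x)) 0) ∂μ :=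
  lintegral_tsum fun m => by fun_prop

lemma mul_densityGap_div {c : ℝ} (hc : 0 < c) (a ρ : ℝ) :
    c * densityGap a (ρ / c) = densityGap (a * c) ρ := by
  have hscale : √c * max (√(ρ / c) - √a) 0 = max (√ρ - √(a * c)) 0 := by
    rw [mul_max_of_nonneg _ _ (Real.sqrt_nonneg c), mul_zero, mul_sub, ← Real.sqrt_mul hc.le,
      ← Real.sqrt_mul hc.le, mul_div_cancel₀ _ hc.ne', mul_comm c]
  rw [densityGap, densityGap, ← hscale, mul_pow, Real.sq_sqrt hc.le]

section Pointwise

variable {B : ℝ}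

/-- The lower bound for the kinetic energy density in terms of the density `ρ`, restricted to the
first `N` Landau levels. -/
noncomputable def kineticGap (B : ℝ) (N : ℕ) (ρ : ℝ) : ℝ :=
  B * (ρ + 2 * ∑ n ∈ Finset.range N, densityGap ((n + 1 : ℕ) * (B / (2 * Real.pi))) ρ)

lemma kineticGap_nonneg (hB : 0 ≤ B) (N : ℕ) {ρ : ℝ} (hρ : 0 ≤ ρ) : 0 ≤ kineticGap B N ρ :=
  mul_nonneg hB (add_nonneg hρ
    (mul_nonneg zero_le_two (Finset.sum_nonneg fun _ _ => densityGap_nonneg _ _)))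

lemma monotone_kineticGap (hB : 0 ≤ B) (ρ : ℝ) : Monotone fun N => kineticGap B N ρ := by
  refine monotone_nat_of_le_succ fun N => ?_
  simp only [kineticGap, Finset.sum_range_succ]
  have := densityGap_nonneg ((N + 1 : ℕ) * (B / (2 * Real.pi))) ρ
  gcongr
  linarith

lemma exists_neg_mul_le_kineticGap (hB : 0 < B) (t : ℝ) {ρ : ℝ} (hρ : 0 ≤ ρ) :
    ∃ N : ℕ, -t * ρ ≤ kineticGap B N ρ +
      3 * (B / (2 * Real.pi) * ∑ m ∈ Finset.range N, max (-((2 * m + 1) * B + t)) 0) := by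
  obtain ⟨c, hc⟩ : ∃ c, c = B / (2 * Real.pi) := ⟨_, rfl⟩
  have hc0 : 0 < c := hc ▸ by positivity
  obtain ⟨N, hN⟩ := exists_mul_le_add_sqrtGapSum (y := -t / B) (r := ρ / c) (by positivity)
  refine ⟨N, ?_⟩
  have hgap : c * sqrtGapSum N (ρ / c) =
      ∑ n ∈ Finset.range N, densityGap ((n + 1 : ℕ) * c) ρ := by
    simp_rw [← mul_densityGap_div hc0, ← Finset.mul_sum, Nat.cast_succ]
    rfl
  have hlevel (m : ℕ) : B * max (-t / B - (2 * m + 1)) 0 = max (-((2 * m + 1) * B + t)) 0 := by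
    rw [mul_max_of_nonneg _ _ hB.le, mul_zero, mul_sub, mul_div_cancel₀ _ hB.ne']
    congr 1
    ring
  rw [kineticGap, ← hc, ← hgap]
  simp_rw [← hlevel, ← Finset.mul_sum]
  calc -t * ρ = c * B * (-t / B * (ρ / c)) := by field_simp
    _ ≤ c * B * (ρ / c + 2 * sqrtGapSum N (ρ / c) +
          3 * ∑ m ∈ Finset.range N, max (-t / B - (2 * m + 1)) 0) := by gcongr
    _ = _ := by field_simp

lemma ofReal_neg_mul_le (hB : 0 < B) (t : ℝ) {ρ : ℝ} (hρ : 0 ≤ ρ) :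
    ENNReal.ofReal (-t * ρ) ≤ (⨆ N, ENNReal.ofReal (kineticGap B N ρ)) +
      3 * (ENNReal.ofReal (B / (2 * Real.pi)) * levelSum B t) := by
  obtain ⟨N, hN⟩ := exists_neg_mul_le_kineticGap hB t hρ
  refine (ENNReal.ofReal_le_ofReal hN).trans (ENNReal.ofReal_add_le.trans (add_le_add
    (le_iSup (fun N => ENNReal.ofReal (kineticGap B N ρ)) N) ?_))
  rw [ENNReal.ofReal_mul (by norm_num), ENNReal.ofReal_mul (by positivity), ENNReal.ofReal_ofNat,
    ENNReal.ofReal_sum_of_nonneg fun m _ => le_max_right _ _]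
  gcongr
  exact ENNReal.sum_le_tsum _

end Pointwise

section LiebThirring

variable {ι : Type*} [Fintype ι] {B : ℝ} {ψ : ι → L2Plane} {g : ι → Fin 2 → L2Plane}

lemma integrable_kineticGap (B : ℝ) (N : ℕ) (ψ : ι → L2Plane) :
    Integrable (fun x => kineticGap B N (density ψ x)) volume :=
  ((integrable_density ψ).add ((integrable_finsetSum _ fun _ _ =>
    integrable_densityGap _ ψ).const_mul 2)).const_mul B

lemma integral_kineticGap (B : ℝ) (N : ℕ) (ψ : ι → L2Plane) :
    ∫ x, kineticGap B N (density ψ x) = B * ((∫ x, density ψ x) + 2 * ∑ n ∈ Finset.range N,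
      ∫ x, densityGap ((n + 1 : ℕ) * (B / (2 * Real.pi))) (density ψ x)) := by
  have hgap (n : ℕ) := integrable_densityGap ((n + 1 : ℕ) * (B / (2 * Real.pi))) ψ
  simp_rw [kineticGap]
  rw [integral_const_mul, integral_add (integrable_density ψ)
    ((integrable_finsetSum _ fun n _ => hgap n).const_mul 2), integral_const_mul,
    integral_finsetSum _ fun n _ => hgap n]

lemma lintegral_iSup_kineticGap_le (hB : 0 < B) (hψ : IsBesselFamily ℂ ψ)
    (h : ∀ i j, IsWeakMagDeriv B j (ψ i) (g i j)) :
    ∫⁻ x, ⨆ N, ENNReal.ofReal (kineticGap B N (density ψ x)) ≤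
      ENNReal.ofReal (∑ i, ∑ j, ‖g i j‖ ^ 2) := by
  rw [lintegral_iSup' (fun N => (integrable_kineticGap B N ψ).aemeasurable.ennreal_ofReal)
    (Filter.Eventually.of_forall fun x => ENNReal.ofReal_mono.comp (monotone_kineticGap hB.le _))]
  refine iSup_le fun N => ?_
  rw [← ofReal_integral_eq_lintegral_ofReal (integrable_kineticGap B N ψ)
    (Filter.Eventually.of_forall fun x => kineticGap_nonneg hB.le N (density_nonneg ψ x)),
    integral_kineticGap]
  exact ENNReal.ofReal_le_ofReal (kinetic_energy_le hB hψ h N)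

theorem lintegral_neg_mul_density_le (hB : 0 < B) (hψ : IsBesselFamily ℂ ψ)
    (h : ∀ i j, IsWeakMagDeriv B j (ψ i) (g i j)) {V : Plane → ℝ} (hV : AEMeasurable V volume) :
    ∫⁻ x, ENNReal.ofReal (-V x * density ψ x) ≤ ENNReal.ofReal (∑ i, ∑ j, ‖g i j‖ ^ 2) +
      3 * (ENNReal.ofReal (B / (2 * Real.pi)) * ∫⁻ x, levelSum B (V x)) := by
  have hm : AEMeasurable (fun x => levelSum B (V x)) volume :=
    (measurable_levelSum B).comp_aemeasurable hV
  calc ∫⁻ x, ENNReal.ofReal (-V x * density ψ x)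
    _ ≤ ∫⁻ x, ((⨆ N, ENNReal.ofReal (kineticGap B N (density ψ x))) +
          3 * (ENNReal.ofReal (B / (2 * Real.pi)) * levelSum B (V x))) :=
        lintegral_mono fun x => ofReal_neg_mul_le hB (V x) (density_nonneg ψ x)
    _ = (∫⁻ x, ⨆ N, ENNReal.ofReal (kineticGap B N (density ψ x))) +
          3 * (ENNReal.ofReal (B / (2 * Real.pi)) * ∫⁻ x, levelSum B (V x)) := by
        rw [lintegral_add_right' _ ((hm.const_mul _).const_mul _),
          lintegral_const_mul'' _ (hm.const_mul _), lintegral_const_mul'' _ hm]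
    _ ≤ _ := by
        gcongr
        exact lintegral_iSup_kineticGap_le hB hψ h

end LiebThirring

/-! ### Weak magnetic derivatives as a closed relation -/

lemma inner_toLp {α : Type*} [MeasurableSpace α] {μ : Measure α} {φ : α → ℂ} (hφ : MemLp φ 2 μ)
    (u : Lp ℂ 2 μ) : inner ℂ hφ.toLp u = ∫ x, conj (φ x) * u x ∂μ := by
  rw [inner_eq_integral]
  refine integral_congr_ae ?_
  filter_upwards [hφ.coeFn_toLp] with x hx
  rw [hx]

section WeakMagDeriv

variable {B : ℝ} {j : Fin 2} {u g u' g' : L2Plane}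

lemma isWeakMagDeriv_iff_inner :
    IsWeakMagDeriv B j u g ↔ ∀ (φ : Plane → ℂ) (h : ContDiff ℝ ∞ φ) (hc : HasCompactSupport φ),
      inner ℂ ((continuous_magDeriv B j (h.of_le (by simp))).memLp_of_hasCompactSupport
        (hasCompactSupport_magDeriv B j hc)).toLp u =
      inner ℂ (h.continuous.memLp_of_hasCompactSupport hc).toLp g := by
  simp_rw [inner_toLp]
  rfl

lemma isWeakMagDeriv_zero (B : ℝ) (j : Fin 2) : IsWeakMagDeriv B j 0 0 :=
  isWeakMagDeriv_iff_inner.2 fun φ _ _ => by rw [inner_zero_right, inner_zero_right]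

lemma IsWeakMagDeriv.add (h : IsWeakMagDeriv B j u g) (h' : IsWeakMagDeriv B j u' g') :
    IsWeakMagDeriv B j (u + u') (g + g') := by
  rw [isWeakMagDeriv_iff_inner] at *
  intro φ hφ hc
  rw [inner_add_right, inner_add_right, h φ hφ hc, h' φ hφ hc]

lemma IsWeakMagDeriv.smul (a : ℂ) (h : IsWeakMagDeriv B j u g) :
    IsWeakMagDeriv B j (a • u) (a • g) := by
  rw [isWeakMagDeriv_iff_inner] at *
  intro φ hφ hc
  rw [inner_smul_right, inner_smul_right, h φ hφ hc]

lemma isClosed_isWeakMagDeriv (B : ℝ) (j : Fin 2) :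
    IsClosed {p : L2Plane × L2Plane | IsWeakMagDeriv B j p.1 p.2} := by
  simp_rw [isWeakMagDeriv_iff_inner, Set.ofPred_forall]
  exact isClosed_iInter fun φ => isClosed_iInter fun hφ => isClosed_iInter fun hc =>
    isClosed_eq (by fun_prop) (by fun_prop)

lemma IsWeakMagDeriv.unique (h : IsWeakMagDeriv B j u g) (h' : IsWeakMagDeriv B j u g') :
    g = g' := by
  rw [← sub_eq_zero, Lp.eq_zero_iff_ae_eq_zero]
  refine ae_eq_zero_of_integral_contDiff_smul_eq_zero
    ((Lp.memLp (g - g')).locallyIntegrable (by norm_num)) fun φ hφ hc => ?_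
  have hψ : ContDiff ℝ ∞ (Complex.ofRealCLM ∘ φ) := by fun_prop
  have hψc : HasCompactSupport (Complex.ofRealCLM ∘ φ) := hc.comp_left rfl
  rw [isWeakMagDeriv_iff_inner] at h h'
  have horth : inner ℂ (hψ.continuous.memLp_of_hasCompactSupport hψc).toLp (g - g') = 0 := by
    rw [inner_sub_right, ← h _ hψ hψc, ← h' _ hψ hψc, sub_self]
  rw [inner_toLp] at horth
  simpa using horth

lemma IsWeakMagDeriv.weakMagDeriv_eq (h : IsWeakMagDeriv B j u g) : weakMagDeriv B j u = g := by
  have hex : ∃ g, IsWeakMagDeriv B j u g := ⟨g, h⟩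
  rw [weakMagDeriv, dif_pos hex]
  exact hex.choose_spec.unique h

lemma isWeakMagDeriv_weakMagDeriv (h : ∃ g, IsWeakMagDeriv B j u g) :
    IsWeakMagDeriv B j u (weakMagDeriv B j u) := by
  obtain ⟨g, hg⟩ := h
  rwa [hg.weakMagDeriv_eq]

end WeakMagDeriv

/-! ### The form bound for the negative part of the potential -/

lemma levelSum_two_mul_add_le {B : ℝ} (hB : 0 ≤ B) (t : ℝ) :
    levelSum B (2 * t + B) ≤ 4 * levelSum B t := by
  let level (m : ℕ) : ℝ≥0∞ := ENNReal.ofReal (max (-(((m : ℝ) + 1) * B + t)) 0)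
  have hrescale : levelSum B (2 * t + B) = 2 * ∑' m : ℕ, level m := by
    rw [← ENNReal.tsum_mul_left]
    refine tsum_congr fun m => ?_
    rw [← ENNReal.ofReal_ofNat 2, ← ENNReal.ofReal_mul zero_le_two,
      mul_max_of_nonneg _ _ zero_le_two, mul_zero]
    ring_nf
  have heven : ∑' k : ℕ, level (2 * k) ≤ levelSum B t :=
    ENNReal.tsum_le_tsum fun k => by simp [level]
  have hodd : ∑' k : ℕ, level (2 * k + 1) ≤ levelSum B t := by
    refine ENNReal.tsum_le_tsum fun k => ENNReal.ofReal_le_ofReal (max_le_max_right _ ?_)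
    push_cast
    linarith
  calc levelSum B (2 * t + B)
      = 2 * (∑' k : ℕ, level (2 * k) + ∑' k : ℕ, level (2 * k + 1)) := by
        rw [hrescale, tsum_even_add_odd ENNReal.summable ENNReal.summable]
    _ ≤ 2 * (levelSum B t + levelSum B t) := by gcongr
    _ = 4 * levelSum B t := by rw [← two_mul, ← mul_assoc]; norm_num

lemma lintegral_levelSum_two_mul_add_le {α : Type*} [MeasurableSpace α] {μ : Measure α} {B : ℝ}
    (hB : 0 ≤ B) {V : α → ℝ} (hV : AEMeasurable V μ) :
    ∫⁻ x, levelSum B (2 * V x + B) ∂μ ≤ 4 * ∫⁻ x, levelSum B (V x) ∂μ := by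
  have hmeas : AEMeasurable (fun x => levelSum B (V x)) μ :=
    (measurable_levelSum B).comp_aemeasurable hV
  rw [← lintegral_const_mul'' _ hmeas]
  exact lintegral_mono fun x => levelSum_two_mul_add_le hB (V x)

lemma two_mul_ofReal_neg_mul_le (B t r : ℝ) :
    2 * ENNReal.ofReal (-t * r) ≤ ENNReal.ofReal (-(2 * t + B) * r) + ENNReal.ofReal (B * r) := by
  rw [← ENNReal.ofReal_ofNat 2, ← ENNReal.ofReal_mul zero_le_two,
    show 2 * (-t * r) = -(2 * t + B) * r + B * r by ring]
  exact ENNReal.ofReal_add_le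

lemma isBesselFamily_singleton {𝕜 H : Type*} [RCLike 𝕜] [NormedAddCommGroup H]
    [InnerProductSpace 𝕜 H] {w : H} (hw : ‖w‖ ≤ 1) : IsBesselFamily 𝕜 fun _ : Unit => w := by
  intro f
  rw [Fintype.sum_unique]
  gcongr
  exact (norm_inner_le_norm w f).trans (mul_le_of_le_one_left (norm_nonneg f) hw)

/-- The constant `C` in the form bound `2 ∫ V₋ |u|² ≤ ‖D₁ u‖² + ‖D₂ u‖² + C ‖u‖²`. -/
noncomputable def formBoundConst (B : ℝ) (V : Plane → ℝ) : ℝ :=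
  B + 12 * (B / (2 * Real.pi)) * (∫⁻ x, levelSum B (V x)).toReal

lemma formBoundConst_nonneg {B : ℝ} (hB : 0 ≤ B) (V : Plane → ℝ) : 0 ≤ formBoundConst B V := by
  unfold formBoundConst
  positivity

lemma ofReal_norm_sq_eq_lintegral {α : Type*} [MeasurableSpace α] {μ : Measure α} (u : Lp ℂ 2 μ) :
    ENNReal.ofReal (‖u‖ ^ 2) = ∫⁻ x, ENNReal.ofReal (‖u x‖ ^ 2) ∂μ := by
  rw [norm_sq_eq_integral, ofReal_integral_eq_lintegral_ofReal (integrable_norm_sq u)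
    (ae_of_all _ fun x => sq_nonneg _)]

section FormBound

variable {B : ℝ} {V : Plane → ℝ} {u : L2Plane} {g : Fin 2 → L2Plane}

lemma lintegral_neg_mul_norm_sq_le (hB : 0 < B) (hV : AEMeasurable V volume) (hu : ‖u‖ ≤ 1)
    (h : ∀ j, IsWeakMagDeriv B j u (g j)) :
    ∫⁻ x, ENNReal.ofReal (-V x * ‖u x‖ ^ 2) ≤ ENNReal.ofReal (∑ j, ‖g j‖ ^ 2) +
      3 * (ENNReal.ofReal (B / (2 * Real.pi)) * ∫⁻ x, levelSum B (V x)) := by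
  simpa [density] using
    lintegral_neg_mul_density_le hB (isBesselFamily_singleton hu) (fun _ => h) hV

-- Applying the inequality to `2 V + B` keeps half of the kinetic energy, and the shift by `B`
-- makes the right side finite, as it turns every level of `2 V` into one of `V`.
lemma two_mul_lintegral_neg_mul_norm_sq_le_of_norm_eq_one (hB : 0 < B)
    (hV : AEMeasurable V volume) (hfin : ∫⁻ x, levelSum B (V x) ≠ ⊤) (hu : ‖u‖ = 1)
    (h : ∀ j, IsWeakMagDeriv B j u (g j)) :
    2 * ∫⁻ x, ENNReal.ofReal (-V x * ‖u x‖ ^ 2) ≤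
      ENNReal.ofReal (∑ j, ‖g j‖ ^ 2 + formBoundConst B V) := by
  let c := B / (2 * Real.pi)
  have hshift := lintegral_neg_mul_norm_sq_le hB (V := fun x => 2 * V x + B) (by fun_prop) hu.le h
  have hlevel : 3 * (ENNReal.ofReal c * ∫⁻ x, levelSum B (2 * V x + B)) ≤
      ENNReal.ofReal (12 * c * (∫⁻ x, levelSum B (V x)).toReal) := by
    calc 3 * (ENNReal.ofReal c * ∫⁻ x, levelSum B (2 * V x + B))
        ≤ 3 * (ENNReal.ofReal c * (4 * ∫⁻ x, levelSum B (V x))) := by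
          gcongr
          exact lintegral_levelSum_two_mul_add_le hB.le hV
      _ = 12 * ENNReal.ofReal c * ∫⁻ x, levelSum B (V x) := by ring
      _ = ENNReal.ofReal (12 * c * (∫⁻ x, levelSum B (V x)).toReal) := by
        rw [ENNReal.ofReal_mul (by positivity), ENNReal.ofReal_mul (by positivity),
          ENNReal.ofReal_toReal hfin, ENNReal.ofReal_ofNat]
  have hmass : ∫⁻ x, ENNReal.ofReal (B * ‖u x‖ ^ 2) = ENNReal.ofReal B := by
    simp_rw [ENNReal.ofReal_mul hB.le]
    rw [lintegral_const_mul' _ _ ENNReal.ofReal_ne_top, ← ofReal_norm_sq_eq_lintegral, hu,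
      one_pow, ENNReal.ofReal_one, mul_one]
  have hkin : 0 ≤ ∑ j, ‖g j‖ ^ 2 := Finset.sum_nonneg fun j _ => sq_nonneg _
  calc 2 * ∫⁻ x, ENNReal.ofReal (-V x * ‖u x‖ ^ 2)
      ≤ ∫⁻ x, (ENNReal.ofReal (-(2 * V x + B) * ‖u x‖ ^ 2) + ENNReal.ofReal (B * ‖u x‖ ^ 2)) := by
        rw [← lintegral_const_mul' _ _ ENNReal.ofNat_ne_top]
        exact lintegral_mono fun x => two_mul_ofReal_neg_mul_le _ _ _
    _ = (∫⁻ x, ENNReal.ofReal (-(2 * V x + B) * ‖u x‖ ^ 2)) + ENNReal.ofReal B := by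
        rw [lintegral_add_right' _ ((integrable_norm_sq u).aemeasurable.const_mul B).ennreal_ofReal,
          hmass]
    _ ≤ ENNReal.ofReal (∑ j, ‖g j‖ ^ 2) +
          ENNReal.ofReal (12 * c * (∫⁻ x, levelSum B (V x)).toReal) + ENNReal.ofReal B :=
        add_le_add_left (hshift.trans (add_le_add_right hlevel _)) _
    _ = ENNReal.ofReal (∑ j, ‖g j‖ ^ 2 + formBoundConst B V) := by
        rw [add_assoc, ← ENNReal.ofReal_add (by positivity) hB.le,
          ← ENNReal.ofReal_add hkin (by positivity), formBoundConst, add_comm B]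

theorem two_mul_lintegral_neg_mul_norm_sq_le (hB : 0 < B) (hV : AEMeasurable V volume)
    (hfin : ∫⁻ x, levelSum B (V x) ≠ ⊤) (h : ∀ j, IsWeakMagDeriv B j u (g j)) :
    2 * ∫⁻ x, ENNReal.ofReal (-V x * ‖u x‖ ^ 2) ≤
      ENNReal.ofReal (∑ j, ‖g j‖ ^ 2 + formBoundConst B V * ‖u‖ ^ 2) := by
  obtain rfl | hu := eq_or_ne u 0
  · simp
  have hu0 : 0 < ‖u‖ := norm_pos_iff.2 hu
  let a : ℂ := ((‖u‖⁻¹ : ℝ) : ℂ)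
  have ha : ‖a‖ = ‖u‖⁻¹ := by simp [a]
  have hscale : ∫⁻ x, ENNReal.ofReal (-V x * ‖u x‖ ^ 2) =
      ENNReal.ofReal (‖u‖ ^ 2) * ∫⁻ x, ENNReal.ofReal (-V x * ‖(a • u) x‖ ^ 2) := by
    rw [← lintegral_const_mul' _ _ ENNReal.ofReal_ne_top]
    refine lintegral_congr_ae ?_
    filter_upwards [Lp.coeFn_smul a u] with x hx
    rw [hx, Pi.smul_apply, norm_smul, ha, ← ENNReal.ofReal_mul (by positivity)]
    field_simp
  have hunit := two_mul_lintegral_neg_mul_norm_sq_le_of_norm_eq_one hB hV hfin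
    (u := a • u) (by rw [norm_smul, ha, inv_mul_cancel₀ hu0.ne']) fun j => (h j).smul a
  calc 2 * ∫⁻ x, ENNReal.ofReal (-V x * ‖u x‖ ^ 2)
      = ENNReal.ofReal (‖u‖ ^ 2) * (2 * ∫⁻ x, ENNReal.ofReal (-V x * ‖(a • u) x‖ ^ 2)) := by
        rw [hscale, mul_left_comm]
    _ ≤ ENNReal.ofReal (‖u‖ ^ 2) * ENNReal.ofReal (∑ j, ‖a • g j‖ ^ 2 + formBoundConst B V) := by
        gcongr
    _ = ENNReal.ofReal (∑ j, ‖g j‖ ^ 2 + formBoundConst B V * ‖u‖ ^ 2) := by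
        rw [← ENNReal.ofReal_mul (by positivity)]
        simp only [norm_smul, ha, mul_pow, Fin.sum_univ_two]
        field_simp

end FormBound

/-! ### The form domain as a Hilbert space -/

/-- `h` is the product of `u` and the real function `m`. As a relation it is closed also for
unbounded `m`. -/
def IsMulBy {α : Type*} [MeasurableSpace α] {μ : Measure α} (m : α → ℝ) (u h : Lp ℂ 2 μ) : Prop :=
  ∀ᵐ x ∂μ, h x = m x * u x

section IsMulBy

variable {α : Type*} [MeasurableSpace α] {μ : Measure α} {m : α → ℝ} {u h u' h' : Lp ℂ 2 μ}

lemma isMulBy_zero (m : α → ℝ) : IsMulBy m (0 : Lp ℂ 2 μ) 0 := by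
  filter_upwards [Lp.coeFn_zero ℂ 2 μ] with x hx
  rw [hx, Pi.zero_apply, mul_zero]

lemma IsMulBy.add (H : IsMulBy m u h) (H' : IsMulBy m u' h') :
    IsMulBy m (u + u') (h + h') := by
  filter_upwards [H, H', Lp.coeFn_add u u', Lp.coeFn_add h h'] with x hx hx' hu hh
  rw [hu, hh, Pi.add_apply, Pi.add_apply, hx, hx', mul_add]

lemma IsMulBy.smul (a : ℂ) (H : IsMulBy m u h) : IsMulBy m (a • u) (a • h) := by
  filter_upwards [H, Lp.coeFn_smul a u, Lp.coeFn_smul a h] with x hx hu hh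
  rw [hu, hh, Pi.smul_apply, Pi.smul_apply, hx, smul_eq_mul, smul_eq_mul, mul_left_comm]

lemma isClosed_isMulBy (m : α → ℝ) : IsClosed {p : Lp ℂ 2 μ × Lp ℂ 2 μ | IsMulBy m p.1 p.2} := by
  refine IsSeqClosed.isClosed fun p q hp hq => ?_
  obtain ⟨ns, hns, hfst⟩ :=
    (tendstoInMeasure_of_tendsto_Lp ((continuous_fst.tendsto q).comp hq)).exists_seq_tendsto_ae
  obtain ⟨ks, hks, hsnd⟩ := (tendstoInMeasure_of_tendsto_Lp
    (((continuous_snd.tendsto q).comp hq).comp hns.tendsto_atTop)).exists_seq_tendsto_ae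
  have hmul : ∀ᵐ x ∂μ, ∀ n, (p n).2 x = m x * (p n).1 x := ae_all_iff.2 hp
  filter_upwards [hfst, hsnd, hmul] with x h₁ h₂ hx
  simp only [Function.comp_apply, hx] at h₁ h₂
  exact tendsto_nhds_unique h₂ ((h₁.comp hks.tendsto_atTop).const_mul _)

lemma IsMulBy.norm_sq_ae_eq (H : IsMulBy (fun x => √(m x)) u h) :
    (fun x => ‖h x‖ ^ 2) =ᵐ[μ] fun x => max (m x) 0 * ‖u x‖ ^ 2 := by
  filter_upwards [H] with x hx
  rw [hx, norm_mul, mul_pow, Complex.norm_real, Real.norm_eq_abs, sq_abs, Real.sq_sqrt']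

lemma IsMulBy.ofReal_norm_sq_eq (H : IsMulBy (fun x => √(m x)) u h) :
    ENNReal.ofReal (‖h‖ ^ 2) = ∫⁻ x, ENNReal.ofReal (m x * ‖u x‖ ^ 2) ∂μ := by
  rw [ofReal_norm_sq_eq_lintegral]
  refine lintegral_congr_ae ?_
  filter_upwards [H.norm_sq_ae_eq] with x hx
  rw [hx, ENNReal.ofReal_mul (le_max_right _ _), ENNReal.ofReal_mul' (sq_nonneg _),
    ENNReal.ofReal_max, ENNReal.ofReal_zero, max_eq_left zero_le]

lemma exists_isMulBy_sqrt (hm : AEMeasurable m μ) (h : Integrable (fun x => m x * ‖u x‖ ^ 2) μ) :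
    ∃ h, IsMulBy (fun x => √(m x)) u h := by
  have hmeas : AEStronglyMeasurable (fun x => (√(m x) : ℂ) * u x) μ :=
    (Complex.measurable_ofReal.comp_aemeasurable hm.sqrt).aestronglyMeasurable.mul
      (Lp.aestronglyMeasurable u)
  have hmem : MemLp (fun x => (√(m x) : ℂ) * u x) 2 μ := by
    rw [memLp_two_iff_integrable_sq_norm hmeas]
    refine h.pos_part.congr (ae_of_all _ fun x => ?_)
    simp only [norm_mul, mul_pow, Complex.norm_real, Real.norm_eq_abs, sq_abs, Real.sq_sqrt',
      max_mul_of_nonneg _ _ (sq_nonneg ‖u x‖), zero_mul]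
  exact ⟨hmem.toLp, hmem.coeFn_toLp⟩

end IsMulBy

/-- The form domain of `H_B + V` as the space of tuples `(u, D₁ u, D₂ u, √V₊ u, √V₋ u)`, on which
the graph norm is the norm of `L²(ℝ²)⁵`. Since `√t = 0` for `t < 0`, no positive parts appear. -/
noncomputable def formSpace (B : ℝ) (V : Plane → ℝ) :
    Submodule ℂ (PiLp 2 fun _ : Fin 5 => L2Plane) where
  carrier := {p | IsWeakMagDeriv B 0 (p 0) (p 1) ∧ IsWeakMagDeriv B 1 (p 0) (p 2) ∧
    IsMulBy (fun x => √(V x)) (p 0) (p 3) ∧ IsMulBy (fun x => √(-V x)) (p 0) (p 4)}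
  add_mem' := fun ⟨h₁, h₂, h₃, h₄⟩ ⟨h₁', h₂', h₃', h₄'⟩ =>
    ⟨h₁.add h₁', h₂.add h₂', h₃.add h₃', h₄.add h₄'⟩
  zero_mem' := ⟨isWeakMagDeriv_zero B 0, isWeakMagDeriv_zero B 1, isMulBy_zero _, isMulBy_zero _⟩
  smul_mem' := fun a _ ⟨h₁, h₂, h₃, h₄⟩ => ⟨h₁.smul a, h₂.smul a, h₃.smul a, h₄.smul a⟩

lemma isClosed_formSpace (B : ℝ) (V : Plane → ℝ) :
    IsClosed (formSpace B V : Set (PiLp 2 fun _ : Fin 5 => L2Plane)) := by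
  have hpair : ∀ i j : Fin 5, Continuous fun p : PiLp 2 fun _ : Fin 5 => L2Plane => (p i, p j) :=
    fun i j => by fun_prop
  exact ((isClosed_isWeakMagDeriv B 0).preimage (hpair 0 1)).inter
    (((isClosed_isWeakMagDeriv B 1).preimage (hpair 0 2)).inter
      (((isClosed_isMulBy _).preimage (hpair 0 3)).inter
        ((isClosed_isMulBy _).preimage (hpair 0 4))))

instance completeSpace_formSpace (B : ℝ) (V : Plane → ℝ) : CompleteSpace (formSpace B V) :=
  (isClosed_formSpace B V).completeSpace_coe

section FormSpace

variable {B : ℝ} {V : Plane → ℝ}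

lemma mem_formDomain_iff (hV : AEMeasurable V volume) {u : L2Plane} :
    u ∈ formDomain B V ↔ ∃ p ∈ formSpace B V, p 0 = u := by
  constructor
  · rintro ⟨hderiv, hint⟩
    obtain ⟨g₁, h₁⟩ := hderiv 0
    obtain ⟨g₂, h₂⟩ := hderiv 1
    obtain ⟨w₃, h₃⟩ := exists_isMulBy_sqrt hV hint
    obtain ⟨w₄, h₄⟩ := exists_isMulBy_sqrt hV.neg
      (hint.neg.congr (ae_of_all _ fun x => (neg_mul _ _).symm))
    exact ⟨WithLp.toLp 2 ![u, g₁, g₂, w₃, w₄], ⟨h₁, h₂, h₃, h₄⟩, rfl⟩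
  · rintro ⟨p, ⟨h₁, h₂, h₃, h₄⟩, rfl⟩
    refine ⟨Fin.forall_fin_two.2 ⟨⟨_, h₁⟩, ⟨_, h₂⟩⟩, ?_⟩
    refine ((integrable_norm_sq (p 3)).sub (integrable_norm_sq (p 4))).congr ?_
    filter_upwards [h₃.norm_sq_ae_eq, h₄.norm_sq_ae_eq] with x hx₃ hx₄
    rw [Pi.sub_apply, hx₃, hx₄, ← sub_mul, max_zero_sub_max_neg_zero_eq_self]

lemma sqrt_mul_self_sub_sqrt_neg_mul_self (t : ℝ) : √t * √t - √(-t) * √(-t) = t := by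
  rw [← sq, ← sq, Real.sq_sqrt', Real.sq_sqrt', max_zero_sub_max_neg_zero_eq_self]

lemma integral_mul_conj_mul_eq {p q : PiLp 2 fun _ : Fin 5 => L2Plane}
    (hp : p ∈ formSpace B V) (hq : q ∈ formSpace B V) :
    ∫ x, (V x : ℂ) * (conj (q 0 x) * p 0 x) = inner ℂ (q 3) (p 3) - inner ℂ (q 4) (p 4) := by
  rw [inner_eq_integral, inner_eq_integral, ← integral_sub
    (integrable_conj_mul (Lp.memLp _) (Lp.memLp _)) (integrable_conj_mul (Lp.memLp _) (Lp.memLp _))]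
  refine integral_congr_ae ?_
  filter_upwards [hp.2.2.1, hp.2.2.2, hq.2.2.1, hq.2.2.2] with x hp₃ hp₄ hq₃ hq₄
  rw [hp₃, hp₄, hq₃, hq₄, map_mul, map_mul, Complex.conj_ofReal, Complex.conj_ofReal]
  nth_rw 1 [← sqrt_mul_self_sub_sqrt_neg_mul_self (V x)]
  push_cast
  ring

lemma landauForm_eq {p q : PiLp 2 fun _ : Fin 5 => L2Plane}
    (hp : p ∈ formSpace B V) (hq : q ∈ formSpace B V) :
    landauForm B V (q 0) (p 0) = inner ℂ (q 1) (p 1) + inner ℂ (q 2) (p 2) +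
      inner ℂ (q 3) (p 3) - inner ℂ (q 4) (p 4) := by
  rw [landauForm, Fin.sum_univ_two, integral_mul_conj_mul_eq hp hq, hp.1.weakMagDeriv_eq,
    hq.1.weakMagDeriv_eq, hp.2.1.weakMagDeriv_eq, hq.2.1.weakMagDeriv_eq, add_sub_assoc]

end FormSpace

/-! ### The resolvent of the operator of the form -/

section LaxMilgram

variable {𝕜 Q H : Type*} [RCLike 𝕜] [NormedAddCommGroup Q] [InnerProductSpace 𝕜 Q]
  [CompleteSpace Q] [NormedAddCommGroup H] [InnerProductSpace 𝕜 H] [CompleteSpace H]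

lemma exists_isPositive_inverse_of_coercive {T : Q →L[𝕜] Q} (hT : T.IsSymmetric) {κ : ℝ}
    (hκ : 0 < κ) (hcoer : ∀ p, κ * ‖p‖ ^ 2 ≤ RCLike.re (inner 𝕜 p (T p))) :
    ∃ S : Q →L[𝕜] Q, S.IsPositive ∧ (∀ p, S (T p) = p) ∧ ∀ p, T (S p) = p := by
  obtain ⟨U, rfl⟩ := T.isUnit_of_forall_le_norm_inner_map (c := ⟨κ, hκ.le⟩) hκ fun p =>
    calc ‖p‖ ^ 2 * κ ≤ RCLike.re (inner 𝕜 p (T p)) := by rw [mul_comm]; exact hcoer p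
      _ ≤ ‖inner 𝕜 p (T p)‖ := RCLike.re_le_norm _
      _ = ‖inner 𝕜 (T p) p‖ := norm_inner_symm _ _
  have hleft : ∀ p, (↑U⁻¹ : Q →L[𝕜] Q) ((U : Q →L[𝕜] Q) p) = p := fun p =>
    DFunLike.congr_fun U.inv_mul p
  have hright : ∀ p, (U : Q →L[𝕜] Q) ((↑U⁻¹ : Q →L[𝕜] Q) p) = p := fun p =>
    DFunLike.congr_fun U.mul_inv p
  refine ⟨↑U⁻¹, ContinuousLinearMap.isPositive_def.2 ⟨fun p q => ?_, fun p => ?_⟩, hleft, hright⟩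
  · have := hT ((↑U⁻¹ : Q →L[𝕜] Q) p) ((↑U⁻¹ : Q →L[𝕜] Q) q)
    simpa only [ContinuousLinearMap.coe_coe, hright] using this.symm
  · have := hcoer ((↑U⁻¹ : Q →L[𝕜] Q) p)
    rw [hright] at this
    exact (by positivity : (0 : ℝ) ≤ _).trans this

/-- The resolvent of a form with domain `Q`, embedded by `J`, is `J T⁻¹ J†`, where `T` represents
the form on `Q`. -/
lemma exists_isPositive_form_resolvent (J : Q →L[𝕜] H) {T : Q →L[𝕜] Q} (hT : T.IsSymmetric)
    {κ : ℝ} (hκ : 0 < κ) (hcoer : ∀ p, κ * ‖p‖ ^ 2 ≤ RCLike.re (inner 𝕜 p (T p))) :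
    ∃ R : H →L[𝕜] H, R.IsPositive ∧
      ∀ f u, (∃ p, J p = u ∧ ∀ q, inner 𝕜 q (T p) = inner 𝕜 (J q) f) ↔ R f = u := by
  obtain ⟨S, hS, hST, hTS⟩ := exists_isPositive_inverse_of_coercive hT hκ hcoer
  refine ⟨J ∘L S ∘L ContinuousLinearMap.adjoint J, hS.conj_adjoint J, fun f u => ⟨?_, ?_⟩⟩
  · rintro ⟨p, rfl, hp⟩
    have hTp : T p = ContinuousLinearMap.adjoint J f :=
      ext_inner_left 𝕜 fun q => by rw [hp, ContinuousLinearMap.adjoint_inner_right]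
    rw [ContinuousLinearMap.comp_apply, ContinuousLinearMap.comp_apply, ← hTp, hST]
  · rintro rfl
    exact ⟨S (ContinuousLinearMap.adjoint J f), rfl, fun q => by
      rw [hTS, ContinuousLinearMap.adjoint_inner_right]⟩

end LaxMilgram

section FormOperator

variable {B : ℝ} {V : Plane → ℝ}

/-- The components of an element of `formSpace B V`. -/
noncomputable def formProj (B : ℝ) (V : Plane → ℝ) (i : Fin 5) : formSpace B V →L[ℂ] L2Plane :=
  (PiLp.proj 2 (fun _ : Fin 5 => L2Plane) i) ∘L (formSpace B V).subtypeL

lemma formProj_apply (i : Fin 5) (p : formSpace B V) : formProj B V i p = p.1 i := rfl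

/-- The bounded operator on `formSpace B V` which represents the form of `H_B + V + c`. -/
noncomputable def formOp (B : ℝ) (V : Plane → ℝ) (c : ℝ) : formSpace B V →L[ℂ] formSpace B V :=
  ∑ i, ((![c, 1, 1, 1, -1] i : ℝ) : ℂ) •
    (ContinuousLinearMap.adjoint (formProj B V i) ∘L formProj B V i)

lemma inner_formOp_eq_sum (c : ℝ) (q p : formSpace B V) :
    inner ℂ q (formOp B V c p) =
      ∑ i, ((![c, 1, 1, 1, -1] i : ℝ) : ℂ) * inner ℂ (q.1 i) (p.1 i) := by
  rw [formOp, sum_apply, inner_sum]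
  refine Finset.sum_congr rfl fun i _ => ?_
  rw [smul_apply, inner_smul_right (𝕜 := ℂ) (E := formSpace B V), ContinuousLinearMap.comp_apply,
    ContinuousLinearMap.adjoint_inner_right, formProj_apply, formProj_apply]

lemma inner_formOp (c : ℝ) (q p : formSpace B V) :
    inner ℂ q (formOp B V c p) = landauForm B V (q.1 0) (p.1 0) + c * inner ℂ (q.1 0) (p.1 0) := by
  rw [inner_formOp_eq_sum, landauForm_eq p.2 q.2]
  simp only [Fin.sum_univ_five, Matrix.cons_val]
  push_cast
  ring

lemma re_inner_formOp_self (c : ℝ) (p : formSpace B V) :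
    (inner ℂ p (formOp B V c p)).re =
      c * ‖p.1 0‖ ^ 2 + ‖p.1 1‖ ^ 2 + ‖p.1 2‖ ^ 2 + ‖p.1 3‖ ^ 2 - ‖p.1 4‖ ^ 2 := by
  have hself : ∀ w : L2Plane, (inner ℂ w w).re = ‖w‖ ^ 2 := fun w =>
    inner_self_eq_norm_sq (𝕜 := ℂ) w
  rw [inner_formOp_eq_sum, Complex.re_sum]
  simp only [Complex.re_ofReal_mul, hself, Fin.sum_univ_five, Matrix.cons_val]
  ring

lemma isSymmetric_formOp (c : ℝ) : (formOp B V c).IsSymmetric := by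
  intro p q
  simp only [ContinuousLinearMap.coe_coe]
  rw [← inner_conj_symm, inner_formOp_eq_sum, inner_formOp_eq_sum, map_sum]
  simp only [map_mul, Complex.conj_ofReal, inner_conj_symm]

lemma formOp_coercive (hB : 0 < B) (hV : AEMeasurable V volume)
    (hfin : ∫⁻ x, levelSum B (V x) ≠ ⊤) (p : formSpace B V) :
    1 / 4 * ‖p‖ ^ 2 ≤ (inner ℂ p (formOp B V (formBoundConst B V + 1) p)).re := by
  obtain ⟨h₁, h₂, -, h₄⟩ := p.2
  have hC := formBoundConst_nonneg hB.le V
  have hneg : 2 * ‖p.1 4‖ ^ 2 ≤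
      ‖p.1 1‖ ^ 2 + ‖p.1 2‖ ^ 2 + formBoundConst B V * ‖p.1 0‖ ^ 2 := by
    rw [← ENNReal.ofReal_le_ofReal_iff (by positivity), ENNReal.ofReal_mul zero_le_two,
      ENNReal.ofReal_ofNat, h₄.ofReal_norm_sq_eq]
    simpa only [Fin.sum_univ_two, Matrix.cons_val] using two_mul_lintegral_neg_mul_norm_sq_le
      (g := ![p.1 1, p.1 2]) hB hV hfin (Fin.forall_fin_two.2 ⟨h₁, h₂⟩)
  have hnorm : ‖p‖ ^ 2 = ∑ i, ‖p.1 i‖ ^ 2 := PiLp.norm_sq_eq_of_L2 _ p.1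
  rw [re_inner_formOp_self, hnorm, Fin.sum_univ_five]
  have := mul_nonneg hC (sq_nonneg ‖p.1 0‖)
  linarith [sq_nonneg ‖p.1 0‖, sq_nonneg ‖p.1 1‖, sq_nonneg ‖p.1 2‖, sq_nonneg ‖p.1 3‖]

lemma mem_landauGraph_iff (hV : AEMeasurable V volume) (c : ℝ) {f u : L2Plane} :
    (u, f - (c : ℂ) • u) ∈ landauGraph B V ↔ ∃ p : formSpace B V, formProj B V 0 p = u ∧
      ∀ q, inner ℂ q (formOp B V c p) = inner ℂ (formProj B V 0 q) f := by
  have hiff : ∀ p q : formSpace B V, inner ℂ q (formOp B V c p) = inner ℂ (q.1 0) f ↔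
      landauForm B V (q.1 0) (p.1 0) = inner ℂ (q.1 0) (f - (c : ℂ) • p.1 0) := fun p q => by
    rw [inner_formOp, inner_sub_right, inner_smul_right, eq_sub_iff_add_eq]
  constructor
  · rintro ⟨hu, hform⟩
    obtain ⟨p, hp, rfl⟩ := (mem_formDomain_iff hV).1 hu
    exact ⟨⟨p, hp⟩, rfl, fun q =>
      (hiff _ q).2 (hform _ ((mem_formDomain_iff hV).2 ⟨q.1, q.2, rfl⟩))⟩
  · rintro ⟨p, rfl, hp⟩
    refine ⟨(mem_formDomain_iff hV).2 ⟨p.1, p.2, rfl⟩, fun v hv => ?_⟩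
    obtain ⟨q, hq, rfl⟩ := (mem_formDomain_iff hV).1 hv
    exact (hiff p ⟨q, hq⟩).1 (hp ⟨q, hq⟩)

theorem exists_isShiftedInverse (hB : 0 < B) (hV : AEMeasurable V volume)
    (hfin : ∫⁻ x, levelSum B (V x) ≠ ⊤) :
    ∃ (c : ℝ) (R : L2Plane →L[ℂ] L2Plane), IsShiftedInverse (landauGraph B V) c R := by
  obtain ⟨R, hR, hgraph⟩ := exists_isPositive_form_resolvent (formProj B V 0)
    (isSymmetric_formOp _) (by norm_num) (formOp_coercive hB hV hfin)
  exact ⟨_, R, hR, fun f u => (mem_landauGraph_iff hV _).trans (hgraph f u)⟩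

end FormOperator

/-! ### The variational inequality -/

section Variational

variable {B : ℝ} {V : Plane → ℝ}

lemma re_landauForm_self (B : ℝ) (V : Plane → ℝ) (u : L2Plane) :
    (landauForm B V u u).re = ∑ j, ‖weakMagDeriv B j u‖ ^ 2 + ∫ x, V x * ‖u x‖ ^ 2 := by
  have hself : ∀ w : L2Plane, (inner ℂ w w).re = ‖w‖ ^ 2 := fun w =>
    inner_self_eq_norm_sq (𝕜 := ℂ) w
  have hpot : ∀ x, (V x : ℂ) * (conj (u x) * u x) = ((V x * ‖u x‖ ^ 2 : ℝ) : ℂ) := fun x => by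
    rw [Complex.conj_mul', Complex.ofReal_mul, Complex.ofReal_pow]
  simp_rw [landauForm, hpot]
  rw [integral_complex_ofReal, Complex.add_re, Complex.re_sum, Complex.ofReal_re]
  simp_rw [hself]

lemma ofReal_integral_le_lintegral_ofReal {α : Type*} [MeasurableSpace α] {μ : Measure α}
    {f : α → ℝ} (hf : Integrable f μ) :
    ENNReal.ofReal (∫ x, f x ∂μ) ≤ ∫⁻ x, ENNReal.ofReal (f x) ∂μ := by
  rw [integral_eq_lintegral_pos_part_sub_lintegral_neg_part hf]
  exact (ENNReal.ofReal_le_ofReal (sub_le_self _ ENNReal.toReal_nonneg)).trans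
    ENNReal.ofReal_toReal_le

theorem neg_sum_landauForm_le {ι : Type*} [Fintype ι] (hB : 0 < B) (hV : AEMeasurable V volume)
    {ψ : ι → L2Plane} (hψ : IsBesselFamily ℂ ψ) (hD : ∀ i, ψ i ∈ formDomain B V) :
    ENNReal.ofReal (-∑ i, (landauForm B V (ψ i) (ψ i)).re) ≤
      3 * (ENNReal.ofReal (B / (2 * Real.pi)) * ∫⁻ x, levelSum B (V x)) := by
  let kin : ℝ := ∑ i, ∑ j, ‖weakMagDeriv B j (ψ i)‖ ^ 2
  have hkin : 0 ≤ kin := Finset.sum_nonneg fun i _ => Finset.sum_nonneg fun j _ => sq_nonneg _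
  have hdensity : (fun x => -V x * density ψ x) = fun x => ∑ i, -(V x * ‖ψ i x‖ ^ 2) := by
    ext x
    simp only [density, Finset.mul_sum, neg_mul]
  have hpot : ∀ i, Integrable (fun x => -(V x * ‖ψ i x‖ ^ 2)) volume := fun i => (hD i).2.neg
  have hint : Integrable (fun x => -V x * density ψ x) volume := by
    rw [hdensity]
    exact integrable_finsetSum _ fun i _ => hpot i
  have hform : -∑ i, (landauForm B V (ψ i) (ψ i)).re = (∫ x, -V x * density ψ x) - kin := by
    rw [hdensity, integral_finsetSum _ fun i _ => hpot i]
    simp only [re_landauForm_self, Finset.sum_add_distrib, integral_neg, Finset.sum_neg_distrib,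
      kin]
    ring
  rw [hform, ENNReal.ofReal_sub _ hkin, tsub_le_iff_left]
  exact (ofReal_integral_le_lintegral_ofReal hint).trans (lintegral_neg_mul_density_le hB hψ
    (fun i j => isWeakMagDeriv_weakMagDeriv ((hD i).1 j)) hV)

end Variational

/-! ### Approximation of the negative part by spectral cutoffs -/

/-- The function `t ↦ 1 / t`, cut off near `t = 0`, where it exceeds `c`. -/
noncomputable def truncInv (c t : ℝ) : ℝ := (max t (|c| + 1)⁻¹)⁻¹

/-- The function `t ↦ (c - 1 / t)₊` which maps `(A + c)⁻¹` to `A₋`, extended continuously to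
`t = 0`. -/
noncomputable def negPartFun (c t : ℝ) : ℝ := max (c - truncInv c t) 0

/-- A continuous cutoff to the region where `negPartFun c` is positive. -/
noncomputable def negPartCutoff (c ε t : ℝ) : ℝ := min 1 (negPartFun c t / ε)

section CutoffFunctions

variable {c ε t : ℝ}

lemma continuous_truncInv (c : ℝ) : Continuous (truncInv c) :=
  Continuous.inv₀ (by fun_prop) fun t => (lt_max_of_lt_right (by positivity)).ne'

lemma continuous_negPartFun (c : ℝ) : Continuous (negPartFun c) :=
  (continuous_const.sub (continuous_truncInv c)).max continuous_const

lemma continuous_negPartCutoff (c ε : ℝ) : Continuous (negPartCutoff c ε) :=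
  continuous_const.min ((continuous_negPartFun c).div_const ε)

lemma negPartFun_nonneg (c t : ℝ) : 0 ≤ negPartFun c t := le_max_right _ _

lemma negPartCutoff_nonneg (c t : ℝ) (hε : 0 ≤ ε) : 0 ≤ negPartCutoff c ε t :=
  le_min zero_le_one (div_nonneg (negPartFun_nonneg c t) hε)

lemma negPartCutoff_eq_zero (h : c ≤ truncInv c t) : negPartCutoff c ε t = 0 := by
  rw [negPartCutoff, negPartFun, max_eq_right (sub_nonpos.2 h), zero_div,
    min_eq_right zero_le_one]

lemma pos_and_truncInv_eq_inv (h : truncInv c t < c) : 0 < t ∧ truncInv c t = t⁻¹ := by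
  have hlt : (|c| + 1)⁻¹ < t := by
    by_contra! hle
    rw [truncInv, max_eq_right hle, inv_inv] at h
    linarith [le_abs_self c]
  exact ⟨(by positivity : 0 < (|c| + 1)⁻¹).trans hlt, by rw [truncInv, max_eq_left hlt.le]⟩

lemma max_mul_sub_one_div_eq_negPartFun (ht : 0 ≤ t) :
    max (c * t - 1) 0 / t = negPartFun c t := by
  obtain h | h := le_or_gt c (truncInv c t)
  · rw [negPartFun, max_eq_right (sub_nonpos.2 h)]
    obtain rfl | ht := ht.eq_or_lt
    · rw [div_zero]
    · have hinv : c ≤ t⁻¹ := h.trans (inv_anti₀ ht (le_max_left _ _))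
      rw [max_eq_right (sub_nonpos.2 ((le_inv_mul_iff₀' ht).1 (by simpa using hinv))), zero_div]
  · obtain ⟨ht, hinv⟩ := pos_and_truncInv_eq_inv h
    have hlt : 1 < c * t := (inv_lt_iff_one_lt_mul₀ ht).1 (hinv ▸ h)
    rw [negPartFun, max_eq_left (sub_pos.2 h).le, hinv, max_eq_left (sub_pos.2 hlt).le, sub_div,
      mul_div_cancel_right₀ _ ht.ne', one_div]

lemma mul_negPartCutoff_mul_truncInv (c ε t : ℝ) :
    t * (negPartCutoff c ε t * truncInv c t) = negPartCutoff c ε t := by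
  obtain h | h := le_or_gt c (truncInv c t)
  · rw [negPartCutoff_eq_zero h, zero_mul, mul_zero]
  · obtain ⟨ht, hinv⟩ := pos_and_truncInv_eq_inv h
    rw [hinv, mul_left_comm, mul_inv_cancel₀ ht.ne', mul_one]

lemma negPartFun_le (c t : ℝ) (hε : 0 < ε) :
    negPartFun c t ≤ negPartCutoff c ε t *
      (c * negPartCutoff c ε t - negPartCutoff c ε t * truncInv c t) + ε := by
  obtain h | h := le_or_gt c (truncInv c t)
  · rw [negPartCutoff_eq_zero h, negPartFun, max_eq_right (sub_nonpos.2 h), zero_mul, zero_add]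
    exact hε.le
  have hg : negPartFun c t = c - truncInv c t := max_eq_left (sub_pos.2 h).le
  have hsq : negPartCutoff c ε t * (c * negPartCutoff c ε t - negPartCutoff c ε t * truncInv c t) =
      negPartCutoff c ε t ^ 2 * negPartFun c t := by
    rw [hg]
    ring
  rw [hsq]
  obtain hle | hle := le_total ε (negPartFun c t)
  · rw [negPartCutoff, min_eq_left ((one_le_div hε).2 hle), one_pow, one_mul]
    exact le_add_of_nonneg_right hε.le
  · exact hle.trans (le_add_of_nonneg_left (mul_nonneg (sq_nonneg _) (negPartFun_nonneg c t)))

end CutoffFunctions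

lemma re_inner_le_re_inner_of_le {H : Type*} [NormedAddCommGroup H] [InnerProductSpace ℂ H]
    {S T : H →L[ℂ] H} (h : S ≤ T) (x : H) :
    (inner ℂ x (S x)).re ≤ (inner ℂ x (T x)).re := by
  have := (ContinuousLinearMap.le_def S T).1 h |>.re_inner_nonneg_right x
  rw [sub_apply, inner_sub_right, map_sub] at this
  exact sub_nonneg.1 this

section CutoffOperators

variable {H : Type*} [NormedAddCommGroup H] [InnerProductSpace ℂ H] [CompleteSpace H]
  {R : H →L[ℂ] H} {c ε : ℝ}

lemma negPartOfShiftedInverse_eq (hR : R.IsPositive) :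
    negPartOfShiftedInverse c R = cfc (negPartFun c) R :=
  cfc_congr fun _ ht => max_mul_sub_one_div_eq_negPartFun <|
    spectrum_nonneg_of_nonneg ((ContinuousLinearMap.nonneg_iff_isPositive R).2 hR) ht

lemma re_inner_negPart_nonneg (hR : R.IsPositive) (x : H) :
    0 ≤ (inner ℂ x (negPartOfShiftedInverse c R x)).re := by
  rw [negPartOfShiftedInverse_eq hR]
  have h : 0 ≤ cfc (negPartFun c) R := cfc_nonneg fun t _ => negPartFun_nonneg c t
  simpa using re_inner_le_re_inner_of_le h x

/-- A smoothed spectral projection of `A` onto the negative axis, as a function of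
`R = (A + c)⁻¹`. -/
noncomputable def cutoffOp (c ε : ℝ) (R : H →L[ℂ] H) : H →L[ℂ] H := cfc (negPartCutoff c ε) R

/-- The operator `(A + c) K` for the cutoff `K = cutoffOp c ε R`, where `R = (A + c)⁻¹`. -/
noncomputable def shiftedCutoffOp (c ε : ℝ) (R : H →L[ℂ] H) : H →L[ℂ] H :=
  cfc (fun t => negPartCutoff c ε t * truncInv c t) R

lemma isSelfAdjoint_cutoffOp (c ε : ℝ) (R : H →L[ℂ] H) : IsSelfAdjoint (cutoffOp c ε R) :=
  cfc_predicate _ R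

lemma norm_cutoffOp_le_one (c : ℝ) (hε : 0 ≤ ε) (R : H →L[ℂ] H) : ‖cutoffOp c ε R‖ ≤ 1 := by
  refine norm_cfc_le zero_le_one fun t _ => ?_
  rw [Real.norm_of_nonneg (negPartCutoff_nonneg c t hε)]
  exact min_le_left _ _

lemma apply_shiftedCutoffOp (hR : IsSelfAdjoint R) (x : H) :
    R (shiftedCutoffOp c ε R x) = cutoffOp c ε R x := by
  have hmul : R * shiftedCutoffOp c ε R = cutoffOp c ε R := by
    have hcont : ContinuousOn (fun t => negPartCutoff c ε t * truncInv c t) (spectrum ℝ R) :=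
      ((continuous_negPartCutoff c ε).mul (continuous_truncInv c)).continuousOn
    nth_rw 1 [← cfc_id' ℝ R]
    rw [shiftedCutoffOp, ← cfc_mul (fun t : ℝ => t) _ R continuousOn_id hcont]
    exact cfc_congr fun t _ => mul_negPartCutoff_mul_truncInv c ε t
  exact DFunLike.congr_fun hmul x

lemma negPartOfShiftedInverse_le (c : ℝ) (hε : 0 < ε) (hR : R.IsPositive) :
    negPartOfShiftedInverse c R ≤ cutoffOp c ε R * (c • cutoffOp c ε R - shiftedCutoffOp c ε R) +
      algebraMap ℝ (H →L[ℂ] H) ε := by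
  have hRsa : IsSelfAdjoint R := hR.isSelfAdjoint
  have := continuous_truncInv c
  have := continuous_negPartCutoff c ε
  have hcfc : cfc (fun t => negPartCutoff c ε t *
      (c * negPartCutoff c ε t - negPartCutoff c ε t * truncInv c t) + ε) R =
      cutoffOp c ε R * (c • cutoffOp c ε R - shiftedCutoffOp c ε R) +
        algebraMap ℝ (H →L[ℂ] H) ε := by
    rw [cfc_add_const .., cfc_mul .., cfc_sub .., cfc_const_mul ..]
    rfl
  rw [negPartOfShiftedInverse_eq hR, ← hcfc]
  exact cfc_mono (fun t _ => negPartFun_le c t hε) (continuous_negPartFun c).continuousOn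

lemma re_inner_negPart_le (c : ℝ) (hε : 0 < ε) (hR : R.IsPositive) (x : H) :
    (inner ℂ x (negPartOfShiftedInverse c R x)).re ≤
      -(inner ℂ (cutoffOp c ε R x) (shiftedCutoffOp c ε R x - (c : ℂ) • cutoffOp c ε R x)).re +
        ε * ‖x‖ ^ 2 := by
  refine (re_inner_le_re_inner_of_le (negPartOfShiftedInverse_le c hε hR) x).trans_eq ?_
  have hconst : (inner ℂ x (algebraMap ℝ (H →L[ℂ] H) ε x)).re = ε * ‖x‖ ^ 2 := by
    rw [Algebra.algebraMap_eq_smul_one, smul_apply, one_apply_eq_self, ← Complex.coe_smul,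
      inner_smul_right, Complex.re_ofReal_mul]
    exact congrArg _ (inner_self_eq_norm_sq (𝕜 := ℂ) x)
  rw [add_apply, inner_add_right, Complex.add_re, hconst, mul_apply_eq_comp,
    ← (isSelfAdjoint_cutoffOp c ε R).isSymmetric.apply_clm, sub_apply, smul_apply,
    ← Complex.coe_smul, ← Complex.neg_re, ← inner_neg_right, neg_sub]

end CutoffOperators

section Trace

lemma isBesselFamily_apply_of_orthonormal {𝕜 ι E H : Type*} [RCLike 𝕜] [Fintype ι]
    [NormedAddCommGroup E] [InnerProductSpace 𝕜 E] [CompleteSpace E] [NormedAddCommGroup H]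
    [InnerProductSpace 𝕜 H] [CompleteSpace H] {b : ι → E} (hb : Orthonormal 𝕜 b)
    {K : E →L[𝕜] H} (hK : ‖K‖ ≤ 1) : IsBesselFamily 𝕜 fun i => K (b i) := by
  intro f
  have hadj : ‖K.adjoint f‖ ≤ ‖f‖ :=
    (K.adjoint.le_of_opNorm_le (by rwa [LinearIsometryEquiv.norm_map]) f).trans_eq (one_mul _)
  simp_rw [← ContinuousLinearMap.adjoint_inner_right]
  exact (hb.sum_inner_products_le _).trans (by gcongr)

variable {B c : ℝ} {V : Plane → ℝ} {R : L2Plane →L[ℂ] L2Plane}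

lemma cutoffOp_mem_formDomain (hR : IsShiftedInverse (landauGraph B V) c R) (ε : ℝ) (x : L2Plane) :
    cutoffOp c ε R x ∈ formDomain B V ∧
      landauForm B V (cutoffOp c ε R x) (cutoffOp c ε R x) =
        inner ℂ (cutoffOp c ε R x) (shiftedCutoffOp c ε R x - (c : ℂ) • cutoffOp c ε R x) := by
  have hmem := (hR.2 _ _).2 (apply_shiftedCutoffOp (c := c) (ε := ε) hR.1.isSelfAdjoint x)
  exact ⟨hmem.1, hmem.2 _ hmem.1⟩

theorem ofReal_sum_re_inner_negPart_le {ι : Type*} {b : ι → L2Plane} (hb : Orthonormal ℂ b)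
    (hB : 0 < B) (hV : AEMeasurable V volume) (hR : IsShiftedInverse (landauGraph B V) c R)
    (s : Finset ι) :
    ENNReal.ofReal (∑ i ∈ s, (inner ℂ (b i) (negPartOfShiftedInverse c R (b i))).re) ≤
      3 * (ENNReal.ofReal (B / (2 * Real.pi)) * ∫⁻ x, levelSum B (V x)) := by
  refine ENNReal.le_of_forall_pos_le_add fun ε hε _ => ?_
  let δ : ℝ := ε / (s.card + 1)
  have hδ : 0 < δ := by positivity
  let ψ : ι → L2Plane := fun i => cutoffOp c δ R (b i)
  have hψ : IsBesselFamily ℂ fun i : s => ψ i := isBesselFamily_apply_of_orthonormal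
    (hb.comp _ Subtype.val_injective) (norm_cutoffOp_le_one c hδ.le R)
  have hform : ∀ i, (inner ℂ (b i) (negPartOfShiftedInverse c R (b i))).re ≤
      -(landauForm B V (ψ i) (ψ i)).re + δ := fun i => by
    have hle := re_inner_negPart_le c hδ hR.1 (b i)
    rwa [hb.1 i, one_pow, mul_one, ← (cutoffOp_mem_formDomain hR δ (b i)).2] at hle
  have hcard : s.card * δ ≤ ε := by
    rw [mul_div_left_comm]
    exact mul_le_of_le_one_right ε.2 ((div_le_one (by positivity)).2 (by simp))
  have hsum : ∑ i ∈ s, (inner ℂ (b i) (negPartOfShiftedInverse c R (b i))).re ≤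
      -∑ i : s, (landauForm B V (ψ i) (ψ i)).re + ε := by
    refine (Finset.sum_le_sum fun i _ => hform i).trans ?_
    rw [Finset.sum_add_distrib, Finset.sum_neg_distrib, Finset.sum_const, nsmul_eq_mul,
      Finset.sum_coe_sort s fun i => (landauForm B V (ψ i) (ψ i)).re]
    gcongr
  refine (ENNReal.ofReal_le_ofReal hsum).trans (ENNReal.ofReal_add_le.trans ?_)
  rw [ENNReal.ofReal_coe_nnreal]
  gcongr
  exact neg_sum_landauForm_le hB hV hψ fun i => (cutoffOp_mem_formDomain hR δ (b i)).1

end Trace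

theorem theorem1p1 {ι : Type*} (b : HilbertBasis ι ℂ L2Plane) (B : ℝ) (hB : 0 < B)
    (V : Plane → ℝ) (hV : AEMeasurable V volume) :
    traceNegPart b (landauGraph B V) ≤
      3 * (ENNReal.ofReal (B / (2 * Real.pi)) *
        ∑' m : ℕ, ∫⁻ x : Plane, ENNReal.ofReal (max (-((2 * (m : ℝ) + 1) * B + V x)) 0)) := by
  rw [← lintegral_levelSum B hV]
  obtain hfin | hfin := eq_or_ne (∫⁻ x, levelSum B (V x)) ⊤
  · have hpos : ENNReal.ofReal (B / (2 * Real.pi)) ≠ 0 := (ENNReal.ofReal_pos.2 (by positivity)).ne'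
    rw [hfin, ENNReal.mul_top hpos, ENNReal.mul_top three_ne_zero]
    exact le_top
  obtain ⟨c, R, hR⟩ := exists_isShiftedInverse hB hV hfin
  have hex : ∃ p : ℝ × (L2Plane →L[ℂ] L2Plane), IsShiftedInverse (landauGraph B V) p.1 p.2 :=
    ⟨(c, R), hR⟩
  rw [traceNegPart, dif_pos hex, ENNReal.tsum_eq_iSup_sum]
  refine iSup_le fun s => ?_
  rw [← ENNReal.ofReal_sum_of_nonneg fun i _ => re_inner_negPart_nonneg hex.choose_spec.1 (b i)]
  exact ofReal_sum_re_inner_negPart_le b.orthonormal hB hV hex.choose_spec s
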